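/- Let $n\ge 1$ and $p\ge 0$ be integers, and let $C_1,\dots,C_{p+1}$ be conjugacy classes in $GL(n,\mathbb{C})$, regarded as (locally closed) subvarieties of the affine space of complex $n\times n$ matrices; let $d_j$ be the dimension of $C_j$. Let $\mathcal V$ be the variety of all $(p+1)$-tuples $(M_1,\dots,M_{p+1})$ with $M_j\in C_j$ for all $j$ and $M_1M_2\cdots M_{p+1}=I$, regarded as a (reduced) subvariety of the affine space of $(p+1)$-tuples of complex $n\times n$ matrices. Let $(M_1,\dots,M_{p+1})\in\mathcal V$ be a tuple with trivial centralizer, i.e. such that the only complex $n\times n$ matrices commuting with all of $M_1,\dots,M_{p+1}$ are the scalar matrices. Then $\mathcal V$ is smooth at the point $(M_1,\dots,M_{p+1})$ (its local ring there is a regular local ring), and the dimension of $\mathcal V$ at this point is $d_1+\dots+d_{p+1}-n^2+1$. -/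

import Mathlib

open scoped MatrixGroups

noncomputable section

/-- The local ring at the point `x` of affine space (with coordinates indexed by `σ`), over `ℂ`:
the rational functions that are regular at `x`. -/
abbrev AffineLocalRing {σ : Type} (x : σ → ℂ) : Type :=
  Localization.AtPrime (MvPolynomial.vanishingIdeal ℂ {x})

/-- The local ring `𝒪_{S,x}` at a point `x ∈ S` of a locally closed subset (reduced subvariety) `S`
of affine space: germs at `x` of regular functions on affine space modulo those vanishing on `S`,
the latter being generated by the polynomials that vanish on `S`. -/
abbrev VarietyLocalRing {σ : Type} (S : Set (σ → ℂ)) (x : σ → ℂ) : Type :=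
  AffineLocalRing x ⧸
    (MvPolynomial.vanishingIdeal ℂ S).map (algebraMap (MvPolynomial σ ℂ) (AffineLocalRing x))

/-- `S` is smooth at `x`: `x` is a point of `S` at which the local ring of `S` is regular. -/
def IsSmoothPoint {σ : Type} (S : Set (σ → ℂ)) (x : σ → ℂ) : Prop :=
  x ∈ S ∧ IsRegularLocalRing (VarietyLocalRing S x)

/-- The dimension of `S` at the point `x`. -/
def varietyDimAt {σ : Type} (S : Set (σ → ℂ)) (x : σ → ℂ) : WithBot ℕ∞ :=
  ringKrullDim (VarietyLocalRing S x)

/-- The dimension of `S`: the largest dimension at a point of `S`. -/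
def varietyDim {σ : Type} (S : Set (σ → ℂ)) : WithBot ℕ∞ :=
  ⨆ x ∈ S, varietyDimAt S x

/-- The entries of an invertible matrix, as a point of the affine space of dimension `n ^ 2`. -/
def entries {n : ℕ} (A : GL (Fin n) ℂ) : Fin n × Fin n → ℂ :=
  fun k => (A : Matrix (Fin n) (Fin n) ℂ) k.1 k.2

/-- All the entries of a tuple of `q` invertible matrices, as a point of the affine space of
dimension `q * n ^ 2`. -/
def tupleEntries {n q : ℕ} (M : Fin q → GL (Fin n) ℂ) : Fin q × Fin n × Fin n → ℂ :=
  fun k => entries (M k.1) k.2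

/-- A conjugacy class of `GL(n, ℂ)`, as a subset of affine space. -/
def conjClassVariety {n : ℕ} (c : ConjClasses (GL (Fin n) ℂ)) : Set (Fin n × Fin n → ℂ) :=
  entries '' c.carrier

/-- The variety of tuples `(M_1, …, M_q)` with `M_j ∈ C_j` and `M_1 ⋯ M_q = I`,
as a subset of affine space. -/
def tupleVariety {n q : ℕ} (C : Fin q → ConjClasses (GL (Fin n) ℂ)) :
    Set (Fin q × Fin n × Fin n → ℂ) :=
  tupleEntries '' {M | (∀ j, M j ∈ (C j).carrier) ∧ (List.ofFn M).prod = 1}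

/-- The only matrices commuting with every `M j` are the scalar ones. -/
def HasTrivialCentralizer {n q : ℕ} (M : Fin q → GL (Fin n) ℂ) : Prop :=
  ∀ X : Matrix (Fin n) (Fin n) ℂ,
    (∀ j, X * (M j : Matrix (Fin n) (Fin n) ℂ) = (M j : Matrix (Fin n) (Fin n) ℂ) * X) →
      ∃ c : ℂ, X = c • (1 : Matrix (Fin n) (Fin n) ℂ)

end

/-! Two bounds pinch the local dimension of the tuple variety between the same numbers.

Upper bound: the local dimension is at most the embedding dimension, which is at most that of the
tangent space `T` cut out by the differentials of all vanishing polynomials. A tangent vector has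
its `j`-th component in the image of `Z ↦ M_j Z - Z M_j`, the tangent space of `C_j`, and is killed
by the derivative of the product map. Under the trace form, a matrix orthogonal to the image of that
derivative commutes with every `M_j`, hence is scalar. So the image has codimension at most 1, and
`dim T ≤ ∑ d_j - n² + 1` (`finrank_tangentSpace_tupleVariety_add_sq_le`).

Lower bound: conjugating `M_j` by `1 + ∑ t_i w_i` gives an immersive rational chart of `C_j` with
`d_j` parameters. Determinants are constant on conjugacy classes, so "product equals `I`" follows
from `n² - 1` of its `n²` scalar equations. Krull's height theorem then gives local dimension at
least `∑ d_j - (n² - 1)` (`sum_adRank_le_varietyDimAt_tupleVariety`, through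
`card_le_varietyDimAt_add_card`).

Hence local dimension, embedding dimension and `dim T` agree, which is regularity. The same pair of
bounds for a single class gives `d_j = adRank M_j`. -/

noncomputable section

/-! ### Commutative algebra: Krull's height theorem and Nakayama's lemma. -/

open IsLocalRing in
/-- If `A → Q` sends the maximal ideal to a generating set of the maximal ideal, and `J` into the
radical of `(F)`, then `dim Q ≤ dim A/J + #F`. -/
theorem ringKrullDim_le_quotient_add_card {A Q : Type*} [CommRing A] [IsLocalRing A]
    [IsNoetherianRing A] [CommRing Q] [IsLocalRing Q] [IsNoetherianRing Q] (f : A →+* Q)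
    (J : Ideal A) (hJm : J ≤ maximalIdeal A) (F : Finset Q) (hF : (F : Set Q) ⊆ maximalIdeal Q)
    (hJ : J.map f ≤ (Ideal.span (F : Set Q)).radical)
    (hm : (maximalIdeal A).map f = maximalIdeal Q) :
    ringKrullDim Q ≤ ringKrullDim (A ⧸ J) + F.card := by
  classical
  have hnt : Nontrivial (A ⧸ J) :=
    Ideal.Quotient.nontrivial_iff.2 fun h =>
      (maximalIdeal.isMaximal A).ne_top (by simpa [h] using hJm)
  have : IsLocalRing (A ⧸ J) :=
    IsLocalRing.of_surjective' (Ideal.Quotient.mk J) Ideal.Quotient.mk_surjective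
  obtain ⟨s, hs, hcard⟩ :=
    Ideal.exists_finset_card_eq_height_of_isNoetherianRing (maximalIdeal (A ⧸ J))
  let g : A ⧸ J → A := Function.surjInv Ideal.Quotient.mk_surjective
  have hg : ∀ y, Ideal.Quotient.mk J (g y) = y :=
    Function.surjInv_eq Ideal.Quotient.mk_surjective
  have hmem : ∀ a, Ideal.Quotient.mk J a ∈ maximalIdeal (A ⧸ J) ↔ a ∈ maximalIdeal A := by
    intro a
    have := ((local_hom_TFAE (Ideal.Quotient.mk J)).out 0 4).1
      (IsLocalHom.of_surjective _ Ideal.Quotient.mk_surjective)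
    rw [← this]; rfl
  let s' : Finset Q := s.image (fun y => f (g y)) ∪ F
  -- Lifts of a system of parameters `s` of `A ⧸ J`, together with `F`, cut out only the closed
  -- point of `Q`: a prime containing them pulls back to a prime over `J` whose image contains `s`,
  -- hence is maximal. The height theorem then bounds the height by the number of elements.
  have key : maximalIdeal Q ∈ (Ideal.span (s' : Set Q)).minimalPrimes := by
    refine ⟨⟨inferInstance, ?_⟩, ?_⟩
    · rw [Ideal.span_le]
      intro q hq
      simp only [s', Finset.coe_union, Finset.coe_image, Set.mem_union, Set.mem_image] at hq
      rcases hq with ⟨y, hy, rfl⟩ | hq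
      · have : g y ∈ maximalIdeal A := by
          rw [← hmem, hg]; exact hs.1.2 (Ideal.subset_span hy)
        exact hm ▸ Ideal.mem_map_of_mem f this
      · exact hF hq
    · rintro P ⟨hP, hle⟩ -
      have hFP : Ideal.span (F : Set Q) ≤ P :=
        (Ideal.span_mono (by simp [s'])).trans hle
      have hJP : J ≤ P.comap f := Ideal.map_le_iff_le_comap.1
        (hJ.trans ((hP.radical_le_iff).2 hFP))
      have hprime : ((P.comap f).map (Ideal.Quotient.mk J)).IsPrime :=
        Ideal.map_isPrime_of_surjective Ideal.Quotient.mk_surjective (by simpa using hJP)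
      have h1 : Ideal.span (s : Set (A ⧸ J)) ≤ (P.comap f).map (Ideal.Quotient.mk J) := by
        rw [Ideal.span_le]
        intro y hy
        rw [← hg y]
        refine Ideal.mem_map_of_mem _ (hle (Ideal.subset_span ?_))
        simp only [s', Finset.coe_union, Finset.coe_image, Set.mem_union, Set.mem_image]
        exact Or.inl ⟨y, hy, rfl⟩
      have h2 := hs.2 ⟨hprime, h1⟩ (le_maximalIdeal hprime.ne_top)
      rw [← hm, Ideal.map_le_iff_le_comap]
      intro a ha
      have h3 : Ideal.Quotient.mk J a ∈ (P.comap f).map (Ideal.Quotient.mk J) :=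
        h2 ((hmem a).2 ha)
      rw [Ideal.mem_map_iff_of_surjective _ Ideal.Quotient.mk_surjective] at h3
      obtain ⟨b, hb, hab⟩ := h3
      have : a - b ∈ J := by rw [← Ideal.Quotient.eq, hab]
      simpa using add_mem (hJP this) hb
  have h4 := Ideal.height_le_card_of_mem_minimalPrimes_span_finset key
  rw [← maximalIdeal_height_eq_ringKrullDim, ← maximalIdeal_height_eq_ringKrullDim, ← hcard]
  have h5 : s'.card ≤ s.card + F.card :=
    (Finset.card_union_le _ _).trans (by gcongr; exact Finset.card_image_le)
  have h6 : (maximalIdeal Q).height ≤ ((s.card + F.card : ℕ) : ℕ∞) :=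
    h4.trans (by exact_mod_cast h5)
  exact_mod_cast h6

open IsLocalRing in
theorem maximalIdeal_le_of_le_sup_sq {R : Type*} [CommRing R] [IsLocalRing R] [IsNoetherianRing R]
    {J : Ideal R} (h : maximalIdeal R ≤ J ⊔ maximalIdeal R ^ 2) : maximalIdeal R ≤ J := by
  apply Submodule.le_of_le_smul_of_le_jacobson_bot (I := maximalIdeal R)
    (IsNoetherian.noetherian _)
  · exact (jacobson_eq_maximalIdeal ⊥ bot_ne_top).ge
  · rwa [smul_eq_mul, ← pow_two]

/-! ### First-order Taylor expansion, dual numbers and Zariski tangent spaces. -/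

namespace MvPolynomial

variable {σ k : Type*} [Field k]

theorem aeval_apply_eq_eval (x : σ → k) (g : MvPolynomial σ k) : aeval x g = eval x g := by
  rw [aeval_eq_eval]

theorem eval_pderiv_mul_X [DecidableEq σ] (x : σ → k) (p : MvPolynomial σ k) (i j : σ) :
    eval x (pderiv i (p * X j)) = x j * eval x (pderiv i p) + if i = j then eval x p else 0 := by
  simp only [Derivation.leibniz, smul_eq_mul, map_add, map_mul, eval_X, pderiv_X, Pi.single_apply]
  split_ifs with h1 h2 h2
  · simp; ring
  · exact absurd h1.symm h2
  · exact absurd h2.symm h1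
  · simp

theorem sub_taylor_mem_sq [Fintype σ] (x : σ → k) (h : MvPolynomial σ k) :
    h - C (eval x h) - ∑ i, C (eval x (pderiv i h)) * (X i - C (x i)) ∈
      (vanishingIdeal k {x}) ^ 2 := by
  classical
  have hX : ∀ i, X i - C (x i) ∈ vanishingIdeal k {x} := by
    intro i; simp
  induction h using MvPolynomial.induction_on with
  | C a => simp
  | add p q hp hq =>
    convert add_mem hp hq using 1
    simp only [map_add, add_mul, Finset.sum_add_distrib]; ring
  | mul_X p j hp =>
    have h1 : ∑ i, C (eval x (pderiv i p)) * (X i - C (x i)) ∈ vanishingIdeal k {x} :=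
      sum_mem fun i _ => Ideal.mul_mem_left _ _ (hX i)
    have h2 : (∑ i, C (eval x (pderiv i p)) * (X i - C (x i))) * (X j - C (x j)) ∈
        (vanishingIdeal k {x}) ^ 2 := by
      rw [pow_two]; exact Ideal.mul_mem_mul h1 (hX j)
    convert add_mem (Ideal.mul_mem_right (X j) _ hp) h2 using 1
    have : ∑ i, C (eval x (pderiv i (p * X j))) * (X i - C (x i)) =
        C (x j) * (∑ i, C (eval x (pderiv i p)) * (X i - C (x i))) +
          C (eval x p) * (X j - C (x j)) := by
      simp only [eval_pderiv_mul_X, map_add, map_mul, add_mul, Finset.sum_add_distrib,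
        Finset.mul_sum, mul_assoc]
      congr 1
      simp [apply_ite (C : k → MvPolynomial σ k), ite_mul]
    rw [this]
    simp only [map_mul, eval_X]
    ring

/-- The Zariski tangent space at `x` of the closed subscheme defined by `I`. -/
def tangentSpace [Fintype σ] (I : Ideal (MvPolynomial σ k)) (x : σ → k) : Submodule k (σ → k) where
  carrier := {v | ∀ g ∈ I, ∑ i, eval x (pderiv i g) * v i = 0}
  zero_mem' := by simp
  add_mem' hv hw g hg := by simp [mul_add, Finset.sum_add_distrib, hv g hg, hw g hg]
  smul_mem' c v hv g hg := by
    simp only [Pi.smul_apply, smul_eq_mul, mul_left_comm _ c, ← Finset.mul_sum, hv g hg, mul_zero]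

/-- The differential at `x`. -/
def differential (x : σ → k) : MvPolynomial σ k →ₗ[k] (σ → k) :=
  LinearMap.pi fun i => (aeval x).toLinearMap ∘ₗ (pderiv i).toLinearMap

theorem differential_apply (x : σ → k) (g : MvPolynomial σ k) (i : σ) :
    differential x g i = eval x (pderiv i g) := by
  simp [differential, aeval_eq_eval]

/-- Tangent vectors become points over the dual numbers, so matrix identities can be differentiated
by substituting `x + ε v`. -/
theorem aeval_dualNumber [Fintype σ] (x v : σ → k) (g : MvPolynomial σ k) :
    aeval (fun i => (TrivSqZeroExt.inl (x i) + TrivSqZeroExt.inr (v i) : DualNumber k)) g =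
      TrivSqZeroExt.inl (eval x g) +
        TrivSqZeroExt.inr (∑ i, eval x (pderiv i g) * v i) := by
  classical
  induction g using MvPolynomial.induction_on with
  | C a => simp [TrivSqZeroExt.algebraMap_eq_inl]
  | add p q hp hq =>
    simp only [map_add, hp, hq, add_mul, Finset.sum_add_distrib, TrivSqZeroExt.inl_add,
      TrivSqZeroExt.inr_add]
    ring
  | mul_X p j hp =>
    rw [map_mul, hp, aeval_X]
    have : ∑ i, eval x (pderiv i (p * X j)) * v i =
        x j * (∑ i, eval x (pderiv i p) * v i) + eval x p * v j := by
      simp only [eval_pderiv_mul_X, add_mul, Finset.sum_add_distrib, Finset.mul_sum, mul_assoc]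
      congr 1
      simp
    rw [this]
    ext
    · simp
    · simp [mul_comm]

theorem mem_tangentSpace_iff [Fintype σ] {I : Ideal (MvPolynomial σ k)} {x v : σ → k} :
    v ∈ tangentSpace I x ↔ ∀ g ∈ I, ∑ i, eval x (pderiv i g) * v i = 0 := Iff.rfl

theorem aeval_dualNumber_eq_zero [Fintype σ] {I : Ideal (MvPolynomial σ k)} {x v : σ → k}
    (hx : I ≤ vanishingIdeal k {x}) (hv : v ∈ tangentSpace I x) {g : MvPolynomial σ k}
    (hg : g ∈ I) :
    aeval (fun i => (TrivSqZeroExt.inl (x i) + TrivSqZeroExt.inr (v i) : DualNumber k)) g = 0 := by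
  have h1 : aeval x g = 0 := (mem_vanishingIdeal_singleton_iff x g).1 (hx hg)
  rw [aeval_apply_eq_eval] at h1
  rw [aeval_dualNumber, h1, hv g hg]
  simp

theorem tangentSpace_eq_comap [Fintype σ] [DecidableEq σ] (I : Ideal (MvPolynomial σ k))
    (x : σ → k) :
    tangentSpace I x = (((I.restrictScalars k).map (differential x)).dualAnnihilator).comap
      (dotProductEquiv k σ).toLinearMap := by
  ext v
  simp only [mem_tangentSpace_iff, Submodule.mem_comap, Submodule.mem_dualAnnihilator,
    Submodule.mem_map, Submodule.restrictScalars_mem, LinearEquiv.coe_coe, forall_exists_index,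
    and_imp, forall_apply_eq_imp_iff₂, dotProductEquiv_apply_apply, dotProduct,
    differential_apply, mul_comm]

/-- The tangent space is the annihilator of the space `W` of differentials of `I`, so a complement
of `W` in the cotangent space has its dimension. Linear forms representing a basis of this
complement supply whatever `I` misses modulo squares. -/
theorem exists_generators_sup_sq [Fintype σ] (I : Ideal (MvPolynomial σ k)) (x : σ → k)
    (hI : I ≤ vanishingIdeal k {x}) :
    ∃ y : Fin (Module.finrank k (tangentSpace I x)) → MvPolynomial σ k,
      (∀ i, y i ∈ vanishingIdeal k {x}) ∧
      vanishingIdeal k {x} ≤ I ⊔ Ideal.span (Set.range y) ⊔ (vanishingIdeal k {x}) ^ 2 := by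
  classical
  set W := (I.restrictScalars k).map (differential x) with hW
  obtain ⟨W', hW'⟩ := W.exists_isCompl
  have h1 : Module.finrank k W' = Module.finrank k (tangentSpace I x) := by
    have e1 := Submodule.finrank_add_eq_of_isCompl hW'
    have e2 := Subspace.finrank_add_finrank_dualAnnihilator_eq W
    have e3 : Module.finrank k (tangentSpace I x) = Module.finrank k W.dualAnnihilator := by
      rw [tangentSpace_eq_comap, Submodule.comap_equiv_eq_map_symm, LinearEquiv.finrank_map_eq]
    omega
  let b := Module.finBasisOfFinrankEq k W' h1
  let lin : (σ → k) →ₗ[k] MvPolynomial σ k :=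
    ∑ i, (LinearMap.proj i : (σ → k) →ₗ[k] k).smulRight (X i - C (x i))
  have lin_apply : ∀ v, lin v = ∑ i, C (v i) * (X i - C (x i)) := by
    intro v; simp [lin, smul_eq_C_mul]
  have lin_mem : ∀ v, lin v ∈ vanishingIdeal k {x} := by
    intro v
    rw [lin_apply]
    exact sum_mem fun i _ => Ideal.mul_mem_left _ _ (by simp)
  have taylor : ∀ h ∈ vanishingIdeal k {x}, h - lin (differential x h) ∈
      (vanishingIdeal k {x}) ^ 2 := by
    intro h hh
    have h1 : aeval x h = 0 := (mem_vanishingIdeal_singleton_iff x h).1 hh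
    rw [aeval_apply_eq_eval] at h1
    have := sub_taylor_mem_sq x h
    simpa [h1, lin_apply, differential_apply] using this
  refine ⟨fun i => lin (b i), fun i => lin_mem _, fun h hh => ?_⟩
  obtain ⟨w, hw, w', hw', hsum⟩ := Submodule.mem_sup.1
    (show differential x h ∈ W ⊔ W' from hW'.sup_eq_top ▸ Submodule.mem_top)
  obtain ⟨g, hg, rfl⟩ := hw
  have hg' : g ∈ I := hg
  have hlin : lin w' ∈ Ideal.span (Set.range fun i => lin (b i)) := by
    have : w' = ((∑ i, b.repr ⟨w', hw'⟩ i • b i : W') : σ → k) := by rw [b.sum_repr]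
    rw [this]
    simp only [Submodule.coe_sum, Submodule.coe_smul, map_sum, map_smul, smul_eq_C_mul]
    exact sum_mem fun i _ => Ideal.mul_mem_left _ _ (Ideal.subset_span ⟨i, rfl⟩)
  -- The linear part of `h` is that of `g` plus `w'`; the bracketed remainders are both of second
  -- order.
  have e : h = g + lin w' + ((h - lin (differential x h)) - (g - lin (differential x g))) := by
    rw [← hsum, map_add]; ring
  rw [e]
  exact Submodule.add_mem_sup (Submodule.add_mem_sup hg' hlin)
    (sub_mem (taylor h hh) (taylor g (hI hg')))

end MvPolynomial

end

/-! ### Local rings of varieties: embedding dimension and a lower bound for dimension. -/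

noncomputable section

open IsLocalRing MvPolynomial

instance AffineLocalRing.isNoetherianRing {σ : Type} [Finite σ] (x : σ → ℂ) :
    IsNoetherianRing (AffineLocalRing x) :=
  IsLocalization.isNoetherianRing (vanishingIdeal ℂ {x}).primeCompl _ inferInstance

theorem AffineLocalRing.maximalIdeal_eq {σ : Type} (x : σ → ℂ) :
    maximalIdeal (AffineLocalRing x) =
      (vanishingIdeal ℂ {x}).map (algebraMap (MvPolynomial σ ℂ) (AffineLocalRing x)) :=
  (Localization.AtPrime.map_eq_maximalIdeal).symm

theorem map_vanishingIdeal_le_maximalIdeal {σ : Type} {S : Set (σ → ℂ)} {x : σ → ℂ} (hx : x ∈ S) :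
    (vanishingIdeal ℂ S).map (algebraMap (MvPolynomial σ ℂ) (AffineLocalRing x)) ≤
      maximalIdeal (AffineLocalRing x) := by
  rw [AffineLocalRing.maximalIdeal_eq]
  exact Ideal.map_mono (vanishingIdeal_anti_mono (Set.singleton_subset_iff.2 hx))

theorem VarietyLocalRing.isLocalRing {σ : Type} {S : Set (σ → ℂ)} {x : σ → ℂ} (hx : x ∈ S) :
    IsLocalRing (VarietyLocalRing S x) := by
  have : Nontrivial (VarietyLocalRing S x) := Ideal.Quotient.nontrivial_iff.2 fun h =>
    (maximalIdeal.isMaximal (AffineLocalRing x)).ne_top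
      (top_le_iff.1 (h ▸ map_vanishingIdeal_le_maximalIdeal hx))
  exact IsLocalRing.of_surjective' (Ideal.Quotient.mk _) Ideal.Quotient.mk_surjective

/-- Since `I` dies in `R`, the generators modulo squares coming from `exists_generators_sup_sq`
generate the maximal ideal by Nakayama. -/
theorem spanFinrank_maximalIdeal_le_of_map {σ R : Type*} [Fintype σ] [CommRing R] [IsLocalRing R]
    [IsNoetherianRing R] (I : Ideal (MvPolynomial σ ℂ)) (x : σ → ℂ) (hI : I ≤ vanishingIdeal ℂ {x})
    (f : MvPolynomial σ ℂ →+* R) (hmax : maximalIdeal R = (vanishingIdeal ℂ {x}).map f)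
    (hIf : I.map f = ⊥) :
    (maximalIdeal R).spanFinrank ≤ Module.finrank ℂ (tangentSpace I x) := by
  obtain ⟨y, hy, hle⟩ := exists_generators_sup_sq I x hI
  have hgen : maximalIdeal R = Ideal.span (Set.range (f ∘ y)) := by
    apply le_antisymm
    · apply maximalIdeal_le_of_le_sup_sq
      have := Ideal.map_mono (f := f) hle
      rwa [Ideal.map_sup, Ideal.map_sup, hIf, bot_sup_eq, Ideal.map_span, Ideal.map_pow,
        ← hmax, ← Set.range_comp] at this
    · rw [Ideal.span_le, hmax]
      rintro _ ⟨i, rfl⟩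
      exact Ideal.mem_map_of_mem f (hy i)
  rw [hgen]
  refine (Submodule.spanFinrank_span_le_ncard_of_finite (Set.finite_range _)).trans ?_
  rw [← Set.image_univ]
  refine (Set.ncard_image_le Set.finite_univ).trans ?_
  simp

theorem spanFinrank_maximalIdeal_le_finrank_tangentSpace {σ : Type} [Fintype σ] {S : Set (σ → ℂ)}
    {x : σ → ℂ} (hx : x ∈ S) [IsLocalRing (VarietyLocalRing S x)] :
    (maximalIdeal (VarietyLocalRing S x)).spanFinrank ≤
      Module.finrank ℂ (tangentSpace (vanishingIdeal ℂ S) x) := by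
  apply spanFinrank_maximalIdeal_le_of_map (R := VarietyLocalRing S x) (vanishingIdeal ℂ S) x
    (vanishingIdeal_anti_mono (Set.singleton_subset_iff.2 hx))
    ((Ideal.Quotient.mk _).comp (algebraMap (MvPolynomial σ ℂ) (AffineLocalRing x)))
  · rw [← Ideal.map_map, ← AffineLocalRing.maximalIdeal_eq]
    exact (map_maximalIdeal_of_surjective _ Ideal.Quotient.mk_surjective).symm
  · rw [← Ideal.map_map, Ideal.map_quotient_self]

theorem varietyDimAt_le_finrank_tangentSpace {σ : Type} [Fintype σ] {S : Set (σ → ℂ)}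
    {x : σ → ℂ} (hx : x ∈ S) :
    varietyDimAt S x ≤ Module.finrank ℂ (tangentSpace (vanishingIdeal ℂ S) x) := by
  have := VarietyLocalRing.isLocalRing hx
  exact (ringKrullDim_le_spanFinrank_maximalIdeal (VarietyLocalRing S x)).trans
    (by exact_mod_cast spanFinrank_maximalIdeal_le_finrank_tangentSpace hx)

theorem isSmoothPoint_of_finrank_tangentSpace_le {σ : Type} [Fintype σ] {S : Set (σ → ℂ)}
    {x : σ → ℂ} (hx : x ∈ S)
    (h : (Module.finrank ℂ (tangentSpace (vanishingIdeal ℂ S) x) : WithBot ℕ∞) ≤ varietyDimAt S x) :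
    IsSmoothPoint S x := by
  have := VarietyLocalRing.isLocalRing hx
  refine ⟨hx, IsRegularLocalRing.of_spanFinrank_maximalIdeal_le _ (le_trans ?_ h)⟩
  exact_mod_cast spanFinrank_maximalIdeal_le_finrank_tangentSpace hx

/-- By the Nullstellensatz every maximal ideal belongs to a point, and translations permute the
points. All maximal ideals thus have the same height, which bounds the dimension of the polynomial
ring. -/
theorem card_le_ringKrullDim_affineLocalRing {τ : Type} [Fintype τ] (x : τ → ℂ) :
    (Fintype.card τ : WithBot ℕ∞) ≤ ringKrullDim (AffineLocalRing x) := by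
  have h1 : ringKrullDim (MvPolynomial τ ℂ) = Fintype.card τ := by
    rw [MvPolynomial.ringKrullDim_of_isNoetherianRing, ringKrullDim_eq_zero_of_field, zero_add,
      Nat.card_eq_fintype_card]
  rw [← h1, IsLocalization.AtPrime.ringKrullDim_eq_height (vanishingIdeal ℂ {x}) (AffineLocalRing x),
    ringKrullDim_le_iff_isMaximal_height_le]
  intro m hm
  obtain ⟨y, rfl⟩ := eq_vanishingIdeal_singleton_of_isMaximal ℂ hm
  let e : MvPolynomial τ ℂ ≃ₐ[ℂ] MvPolynomial τ ℂ :=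
    AlgEquiv.ofAlgHom (aeval fun i => X i + C (y i - x i)) (aeval fun i => X i + C (x i - y i))
      (by ext1 i; simp; ring) (by ext1 i; simp; ring)
  have : vanishingIdeal ℂ {y} = (vanishingIdeal ℂ {x}).comap (e : MvPolynomial τ ℂ ≃+* _) := by
    ext g
    have : aeval x (e g) = aeval y g := by
      change (aeval x) (aeval _ g) = _
      rw [← AlgHom.comp_apply, comp_aeval]
      simp
    rw [Ideal.mem_comap, mem_vanishingIdeal_singleton_iff, mem_vanishingIdeal_singleton_iff, ← this]
    rfl
  rw [this, RingEquiv.height_comap]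

/-- The same `a` and `b` must serve every algebra `E`: they are used both in the local ring at `0`,
where the fractions `N / D` are germs, and at complex points, where they are numbers. -/
theorem exists_clear_denominators {σ τ : Type} (N D : σ → MvPolynomial τ ℂ) (g : MvPolynomial σ ℂ) :
    ∃ a b : MvPolynomial τ ℂ, ∀ (E : Type) [CommRing E] [Algebra ℂ E]
      (ψ : MvPolynomial τ ℂ →ₐ[ℂ] E) (u : σ → E), (∀ k, u k * ψ (D k) = ψ (N k)) →
      (∀ k, IsUnit (ψ (D k))) → IsUnit (ψ b) ∧ ψ a = ψ b * aeval u g := by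
  induction g using MvPolynomial.induction_on with
  | C c => exact ⟨C c, 1, fun E _ _ ψ u h hD => ⟨by simp, by simp [← algebraMap_eq]⟩⟩
  | add p q hp hq =>
    obtain ⟨a, b, h⟩ := hp
    obtain ⟨a', b', h'⟩ := hq
    refine ⟨a * b' + a' * b, b * b', fun E _ _ ψ u hu hD => ?_⟩
    obtain ⟨h1, h2⟩ := h E ψ u hu hD
    obtain ⟨h3, h4⟩ := h' E ψ u hu hD
    refine ⟨by rw [map_mul]; exact h1.mul h3, ?_⟩
    simp only [map_add, map_mul, h2, h4]; ring
  | mul_X p j hp =>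
    obtain ⟨a, b, h⟩ := hp
    refine ⟨a * N j, b * D j, fun E _ _ ψ u hu hD => ?_⟩
    obtain ⟨h1, h2⟩ := h E ψ u hu hD
    refine ⟨by rw [map_mul]; exact h1.mul (hD j), ?_⟩
    simp only [map_mul, h2, aeval_X, ← hu j]; ring

open scoped Classical in
/-- If `t ↦ (N k t / D k t)` is immersive at `0` and maps the zeros of `F` near `0` into `S`, then
the dimension of `S` at the image of `0` is at least the number of parameters minus the number of
equations. -/
theorem card_le_varietyDimAt_add_card {σ τ κ : Type} [Fintype σ] [Fintype τ] [Fintype κ]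
    (S : Set (σ → ℂ)) (x : σ → ℂ) (N D : σ → MvPolynomial τ ℂ) (F : κ → MvPolynomial τ ℂ)
    (hD : ∀ k, eval 0 (D k) ≠ 0) (hN : ∀ k, eval 0 (N k) = x k * eval 0 (D k))
    (hF : ∀ i, eval 0 (F i) = 0)
    (hS : ∀ t, (∀ k, eval t (D k) ≠ 0) → (∀ i, eval t (F i) = 0) →
      (fun k => eval t (N k) / eval t (D k)) ∈ S)
    (himm : tangentSpace (Ideal.span (Set.range fun k => N k - C (x k) * D k)) 0 = ⊥) :
    (Fintype.card τ : WithBot ℕ∞) ≤ varietyDimAt S x + Fintype.card κ := by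
  have hx : x ∈ S := by
    convert hS 0 hD hF with k
    rw [hN, mul_div_cancel_right₀ _ (hD k)]
  let Q := AffineLocalRing (0 : τ → ℂ)
  let ι : MvPolynomial τ ℂ →ₐ[ℂ] Q := Algebra.algHom ℂ (MvPolynomial τ ℂ) Q
  have hι : ∀ a, IsUnit (ι a) ↔ eval 0 a ≠ 0 := by
    intro a
    have := IsLocalization.AtPrime.isUnit_to_map_iff Q (vanishingIdeal ℂ {(0 : τ → ℂ)}) a
    refine this.trans ?_
    rw [Ideal.mem_primeCompl_iff, mem_vanishingIdeal_singleton_iff, aeval_apply_eq_eval]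
  have hιm : ∀ a, ι a ∈ maximalIdeal Q ↔ eval 0 a = 0 := by
    intro a; rw [mem_maximalIdeal, mem_nonunits_iff, hι, not_not]
  have hιD : ∀ k, IsUnit (ι (D k)) := fun k => (hι _).2 (hD k)
  let u : σ → Q := fun k => ι (N k) * ((hιD k).unit⁻¹ : Qˣ)
  have hu : ∀ k, u k * ι (D k) = ι (N k) := fun k => by
    simp only [u, mul_assoc, IsUnit.val_inv_mul, mul_one]
  let φ₀ : MvPolynomial σ ℂ →ₐ[ℂ] Q := aeval u
  have clear : ∀ g, ∃ a b, IsUnit (ι b) ∧ ι a = ι b * φ₀ g ∧ (∀ t, (∀ k, eval t (D k) ≠ 0) →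
      eval t b ≠ 0 ∧ eval t a = eval t b * eval (fun k => eval t (N k) / eval t (D k)) g) := by
    intro g
    obtain ⟨a, b, h⟩ := exists_clear_denominators N D g
    obtain ⟨h1, h2⟩ := h Q ι u hu hιD
    refine ⟨a, b, h1, h2, fun t ht => ?_⟩
    obtain ⟨h3, h4⟩ := h ℂ (aeval t) (fun k => eval t (N k) / eval t (D k))
      (fun k => by rw [aeval_apply_eq_eval]; exact div_mul_cancel₀ _ (ht k))
      (fun k => by rw [aeval_apply_eq_eval]; exact (ht k).isUnit)
    simp only [aeval_apply_eq_eval] at h3 h4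
    exact ⟨h3.ne_zero, h4⟩
  have hpt : (fun k => eval 0 (N k) / eval 0 (D k)) = x := by
    ext k; rw [hN, mul_div_cancel_right₀ _ (hD k)]
  have hφ₀ : ∀ g, φ₀ g ∈ maximalIdeal Q ↔ eval x g = 0 := by
    intro g
    obtain ⟨a, b, hb, hab, ht⟩ := clear g
    obtain ⟨h1, h2⟩ := ht 0 hD
    rw [← Ideal.unit_mul_mem_iff_mem _ hb, ← hab, hιm, h2, hpt, mul_eq_zero, or_iff_right h1]
  let φ : AffineLocalRing x →+* Q := IsLocalization.lift (M := (vanishingIdeal ℂ {x}).primeCompl)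
    (g := φ₀.toRingHom) (by
      rintro ⟨g, hg⟩
      rw [Ideal.mem_primeCompl_iff, mem_vanishingIdeal_singleton_iff, aeval_apply_eq_eval] at hg
      by_contra hne
      exact hg ((hφ₀ g).1 hne))
  have hφ : φ.comp (algebraMap (MvPolynomial σ ℂ) (AffineLocalRing x)) = φ₀.toRingHom :=
    IsLocalization.lift_comp _
  have hmapQ : maximalIdeal Q = (vanishingIdeal ℂ {(0 : τ → ℂ)}).map ι.toRingHom :=
    AffineLocalRing.maximalIdeal_eq (0 : τ → ℂ)
  have hmap : (maximalIdeal (AffineLocalRing x)).map φ = maximalIdeal Q := by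
    rw [AffineLocalRing.maximalIdeal_eq, Ideal.map_map, hφ]
    apply le_antisymm
    · rw [Ideal.map_le_iff_le_comap]
      intro g hg
      rw [mem_vanishingIdeal_singleton_iff, aeval_apply_eq_eval] at hg
      exact (hφ₀ g).2 hg
    -- By immersivity the elements `N k - x k * D k` generate the maximal ideal at `0` modulo its
    -- square, and in `Q` each is a unit times the image of `X k - x k`.
    · apply maximalIdeal_le_of_le_sup_sq (R := Q)
      have hle : vanishingIdeal ℂ {(0 : τ → ℂ)} ≤
          Ideal.span (Set.range fun k => N k - C (x k) * D k) ⊔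
            vanishingIdeal ℂ {(0 : τ → ℂ)} ^ 2 := by
        obtain ⟨y, -, hle⟩ := exists_generators_sup_sq
          (Ideal.span (Set.range fun k => N k - C (x k) * D k)) 0 (by
            rw [Ideal.span_le]
            rintro _ ⟨k, rfl⟩
            show _ ∈ vanishingIdeal ℂ _
            rw [mem_vanishingIdeal_singleton_iff, aeval_apply_eq_eval, map_sub, map_mul, hN, eval_C,
              sub_self])
        have hfr : Module.finrank ℂ (tangentSpace (Ideal.span
            (Set.range fun k => N k - C (x k) * D k)) 0) = 0 := by
          rw [himm]; simp
        have : IsEmpty (Fin (Module.finrank ℂ (tangentSpace (Ideal.span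
            (Set.range fun k => N k - C (x k) * D k)) 0))) := by
          rw [hfr]; infer_instance
        rwa [Set.range_eq_empty y, Ideal.span_empty, sup_bot_eq] at hle
      have h3 := Ideal.map_mono (f := ι.toRingHom) hle
      rw [Ideal.map_sup, Ideal.map_pow, ← hmapQ] at h3
      refine h3.trans (sup_le_sup_right ?_ _)
      rw [Ideal.map_le_iff_le_comap, Ideal.span_le]
      rintro _ ⟨k, rfl⟩
      have : ι (N k - C (x k) * D k) = ι (D k) * φ₀ (X k - C (x k)) := by
        have hC : ι (C (x k)) = algebraMap ℂ Q (x k) := ι.commutes (x k)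
        have hC' : φ₀ (C (x k)) = algebraMap ℂ Q (x k) := φ₀.commutes (x k)
        rw [map_sub, map_sub, map_mul, hC, hC', ← hu k]
        simp only [φ₀, aeval_X]; ring
      show ι (N k - C (x k) * D k) ∈ Ideal.map φ₀.toRingHom (vanishingIdeal ℂ {x})
      rw [this]
      exact Ideal.mul_mem_left _ _ (Ideal.mem_map_of_mem φ₀.toRingHom (by simp))
  let G : Finset Q := Finset.univ.image fun i => ι (F i)
  have hG : (G : Set Q) = Set.range fun i => ι (F i) := by simp [G]
  have hGm : (G : Set Q) ⊆ maximalIdeal Q := by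
    rw [hG]; rintro _ ⟨i, rfl⟩; exact (hιm _).2 (hF i)
  have hrad : ((vanishingIdeal ℂ S).map
      (algebraMap (MvPolynomial σ ℂ) (AffineLocalRing x))).map φ ≤ (Ideal.span (G : Set Q)).radical := by
    rw [Ideal.map_map, hφ, Ideal.map_le_iff_le_comap]
    intro g hg
    obtain ⟨a, b, hb, hab, ht⟩ := clear g
    -- Nullstellensatz: at a zero of `F`, either some `D k` vanishes, or the image point lies in `S`
    -- and `g` vanishes there. The factors `D k` and `b` are units in `Q` and are cancelled below.
    have h1 : a * ∏ k, D k ∈ (Ideal.span (Set.range F)).radical := by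
      rw [← vanishingIdeal_zeroLocus_eq_radical (K := ℂ)]
      intro t htz
      rw [zeroLocus_span] at htz
      rw [aeval_apply_eq_eval, map_mul, map_prod]
      by_cases hDt : ∀ k, eval t (D k) ≠ 0
      · have h2 := hS t hDt fun i => by
          have := htz (F i) ⟨i, rfl⟩
          rwa [aeval_apply_eq_eval] at this
        have h3 := hg _ h2
        rw [aeval_apply_eq_eval] at h3
        rw [(ht t hDt).2, h3]; simp
      · push Not at hDt
        obtain ⟨k, hk⟩ := hDt
        rw [Finset.prod_eq_zero (Finset.mem_univ k) hk, mul_zero]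
    have h2 := Ideal.map_radical_le ι.toRingHom (Ideal.mem_map_of_mem ι.toRingHom h1)
    rw [Ideal.map_span, ← Set.range_comp] at h2
    have h3 : (Ideal.span (G : Set Q)) = Ideal.span (Set.range (ι.toRingHom ∘ F)) := by
      rw [hG]; rfl
    rw [← h3] at h2
    have h4 : ι (a * ∏ k, D k) ∈ (Ideal.span (G : Set Q)).radical := h2
    rw [map_mul, map_prod, hab, mul_comm, ← mul_assoc, Ideal.unit_mul_mem_iff_mem] at h4
    · exact h4
    · exact (IsUnit.prod_univ_iff.2 hιD).mul hb
  have := ringKrullDim_le_quotient_add_card φ _ (map_vanishingIdeal_le_maximalIdeal hx) G hGm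
    hrad hmap
  refine (card_le_ringKrullDim_affineLocalRing (0 : τ → ℂ)).trans (this.trans ?_)
  refine add_le_add le_rfl ?_
  exact_mod_cast Finset.card_image_le

end

/-! ### The map `Z ↦ A Z - Z B`: ranks and minors detecting tangent directions. -/

noncomputable section

open MvPolynomial TrivSqZeroExt

/-- The linear map `Z ↦ A * Z - Z * B`. -/
def sylvester {n : ℕ} (A B : Matrix (Fin n) (Fin n) ℂ) :
    Matrix (Fin n) (Fin n) ℂ →ₗ[ℂ] Matrix (Fin n) (Fin n) ℂ :=
  LinearMap.mulLeft ℂ A - LinearMap.mulRight ℂ B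

theorem sylvester_apply {n : ℕ} (A B Z : Matrix (Fin n) (Fin n) ℂ) :
    sylvester A B Z = A * Z - Z * B := rfl

/-- The rank of `Z ↦ A * Z - Z * A`. -/
def adRank {n : ℕ} (A : Matrix (Fin n) (Fin n) ℂ) : ℕ :=
  Module.finrank ℂ (LinearMap.range (sylvester A A))

/-- The conjugated map factors through `sylvester A A` by two-sided multiplications. Separate pairs
`g`, `h` cover both conjugating only `B` and conjugating both sides. -/
theorem finrank_range_sylvester_conj_le {n : ℕ} {A g g' h h' : Matrix (Fin n) (Fin n) ℂ}
    (hg : g * g' = 1) (hh : h * h' = 1) :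
    Module.finrank ℂ (LinearMap.range (sylvester (g * A * g') (h * A * h'))) ≤ adRank A := by
  let e (a b : Matrix (Fin n) (Fin n) ℂ) := LinearMap.mulLeft ℂ a ∘ₗ LinearMap.mulRight ℂ b
  have : sylvester (g * A * g') (h * A * h') = e g h' ∘ₗ sylvester A A ∘ₗ e g' h := by
    have hh' : ∀ Z, Z * h * h' = Z := fun Z => by rw [mul_assoc, hh, mul_one]
    have hg' : ∀ Z, g * (g' * Z) = Z := fun Z => by rw [← mul_assoc, hg, one_mul]
    ext1 Z
    simp only [sylvester_apply, e, LinearMap.comp_apply, LinearMap.mulLeft_apply,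
      LinearMap.mulRight_apply, sub_mul, mul_sub]
    congr 1
    · simp only [← mul_assoc, hh']
    · simp only [mul_assoc, hg']
  rw [this, LinearMap.range_comp]
  exact (Submodule.finrank_map_le _ _).trans
    (Submodule.finrank_mono (LinearMap.range_comp_le_range _ _))

theorem LinearMap.exists_linearIndependent_comp {K V V' : Type*} [Field K] [AddCommGroup V]
    [Module K V] [AddCommGroup V'] [Module K V'] [FiniteDimensional K V'] (f : V →ₗ[K] V') :
    ∃ w : Fin (Module.finrank K (LinearMap.range f)) → V, LinearIndependent K fun i => f (w i) := by
  let e := Module.finBasis K (LinearMap.range f)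
  have hw : ∀ i, ∃ w, f w = e i := fun i => (e i).2
  choose w hw using hw
  refine ⟨w, ?_⟩
  simp only [hw]
  exact e.linearIndependent.map' _ (Submodule.ker_subtype _)

theorem exists_linearIndependent_sylvester {n : ℕ} (A : Matrix (Fin n) (Fin n) ℂ) :
    ∃ w : Fin (adRank A) → Matrix (Fin n) (Fin n) ℂ,
      LinearIndependent ℂ fun i => sylvester A A (w i) :=
  (sylvester A A).exists_linearIndependent_comp

theorem LinearIndependent.exists_dual_family {ι K V : Type*} [Fintype ι] [DecidableEq ι] [Field K]
    [AddCommGroup V] [Module K V] {f : ι → V} (hf : LinearIndependent K f) :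
    ∃ P : V →ₗ[K] (ι → K), ∀ i, P (f i) = Pi.single i 1 := by
  obtain ⟨P, hP⟩ := LinearMap.exists_leftInverse_of_injective
    (Fintype.linearCombination K f) (LinearMap.ker_eq_bot.2
      (linearIndependent_iff_injective_fintypeLinearCombination.1 hf))
  refine ⟨P, fun i => ?_⟩
  have := LinearMap.congr_fun hP (Pi.single i 1)
  simpa [Fintype.linearCombination_apply_single] using this

section Minor

variable {n m : ℕ}

/-- The matrix of `Z ↦ A * Z - Z * B` with respect to a family `q` of matrices and a family `P` of
linear forms. -/
def sylvesterMatrix (A : Matrix (Fin n) (Fin n) ℂ) (q : Fin m → Matrix (Fin n) (Fin n) ℂ)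
    (P : Matrix (Fin n) (Fin n) ℂ →ₗ[ℂ] (Fin m → ℂ)) {E : Type} [CommRing E] [Algebra ℂ E]
    (B : Matrix (Fin n) (Fin n) E) : Matrix (Fin m) (Fin m) E :=
  Matrix.of fun i j => ∑ a, ∑ b, algebraMap ℂ E (P (Matrix.single a b 1) i) *
    ((A * q j).map (algebraMap ℂ E) - (q j).map (algebraMap ℂ E) * B) a b

variable (A : Matrix (Fin n) (Fin n) ℂ) (q : Fin m → Matrix (Fin n) (Fin n) ℂ)
  (P : Matrix (Fin n) (Fin n) ℂ →ₗ[ℂ] (Fin m → ℂ))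

theorem aeval_det_sylvesterMatrix {E : Type} [CommRing E] [Algebra ℂ E] (u : Fin n × Fin n → E) :
    aeval u (sylvesterMatrix A q P (Matrix.of fun a b =>
      (X (a, b) : MvPolynomial (Fin n × Fin n) ℂ))).det =
      (sylvesterMatrix A q P (Matrix.of fun a b => u (a, b))).det := by
  rw [AlgHom.map_det]
  congr 1
  ext i j
  simp [sylvesterMatrix, Matrix.mul_apply]

theorem linearMap_apply_eq_sum (Z : Matrix (Fin n) (Fin n) ℂ) (i : Fin m) :
    P Z i = ∑ a, ∑ b, P (Matrix.single a b 1) i * Z a b := by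
  conv_lhs => rw [Matrix.matrix_eq_sum_single Z]
  simp only [map_sum, Finset.sum_apply]
  refine Finset.sum_congr rfl fun a _ => Finset.sum_congr rfl fun b _ => ?_
  have : Matrix.single a b (Z a b) = Z a b • Matrix.single a b (1 : ℂ) := by simp
  rw [this, map_smul, Pi.smul_apply, smul_eq_mul, mul_comm]

theorem sylvesterMatrix_apply (B : Matrix (Fin n) (Fin n) ℂ) (i j : Fin m) :
    sylvesterMatrix A q P B i j = P (sylvester A B (q j)) i := by
  rw [linearMap_apply_eq_sum]
  rfl

/-- If the rank is below `m`, some nontrivial combination of the `q j` lies in the kernel and gives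
a vector killed by the matrix. -/
theorem det_sylvesterMatrix_eq_zero (B : Matrix (Fin n) (Fin n) ℂ)
    (hB : Module.finrank ℂ (LinearMap.range (sylvester A B)) < m) :
    (sylvesterMatrix A q P B).det = 0 := by
  let L : (Fin m → ℂ) →ₗ[ℂ] LinearMap.range (sylvester A B) :=
    (sylvester A B).rangeRestrict ∘ₗ Fintype.linearCombination ℂ q
  have hker : LinearMap.ker L ≠ ⊥ := by
    apply LinearMap.ker_ne_bot_of_finrank_lt
    rwa [Module.finrank_fin_fun]
  obtain ⟨c, hc, hc0⟩ := Submodule.exists_mem_ne_zero_of_ne_bot hker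
  rw [← Matrix.exists_mulVec_eq_zero_iff]
  refine ⟨c, hc0, ?_⟩
  have h1 : sylvester A B (∑ j, c j • q j) = 0 := by
    have := congrArg Subtype.val (LinearMap.mem_ker.1 hc)
    simpa [L, Fintype.linearCombination_apply] using this
  ext i
  have h2 := congrFun (congrArg P h1) i
  simp only [Matrix.mulVec, dotProduct, sylvesterMatrix_apply]
  simpa [mul_comm] using h2

theorem fst_sylvesterMatrix (B : Matrix (Fin n) (Fin n) (DualNumber ℂ)) (i j : Fin m) :
    fst (sylvesterMatrix A q P B i j) = P (sylvester A (B.map fst) (q j)) i := by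
  rw [linearMap_apply_eq_sum]
  simp [sylvesterMatrix, Matrix.mul_apply, sylvester_apply, algebraMap_eq_inl, fst_sum]

theorem sylvesterMatrix_dualNumber (Y : Matrix (Fin n) (Fin n) ℂ) {j : Fin m} (hj : q j = 1)
    (i : Fin m) :
    sylvesterMatrix A q P (Matrix.of fun a b => (inl (A a b) + inr (Y a b) : DualNumber ℂ)) i j =
      -inr (P Y i) := by
  rw [linearMap_apply_eq_sum]
  simp only [sylvesterMatrix, Matrix.of_apply]
  have : ∀ a b, ((A * q j).map (algebraMap ℂ (DualNumber ℂ)) -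
      (q j).map (algebraMap ℂ (DualNumber ℂ)) *
        (Matrix.of fun a b => (inl (A a b) + inr (Y a b) : DualNumber ℂ))) a b =
      - inr (Y a b) := by
    intro a b
    have h1 : (1 : Matrix (Fin n) (Fin n) ℂ).map (algebraMap ℂ (DualNumber ℂ)) = 1 := by simp
    rw [hj, h1, mul_one, one_mul]
    simp [algebraMap_eq_inl]
  simp only [this]
  ext <;> simp [fst_sum, snd_sum, algebraMap_eq_inl, mul_comm]

end Minor

/-- A tangent direction `Y` at `A` outside the image of `Z ↦ A * Z - Z * A` is detected by a minor of
`Z ↦ A * Z - Z * B`, as a polynomial in `B`. -/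
theorem exists_separating_polynomial {n : ℕ} (A Y : Matrix (Fin n) (Fin n) ℂ)
    (hY : Y ∉ LinearMap.range (sylvester A A)) :
    ∃ g : MvPolynomial (Fin n × Fin n) ℂ,
      (∀ B, Module.finrank ℂ (LinearMap.range (sylvester A B)) ≤ adRank A →
        aeval (fun k => B k.1 k.2) g = 0) ∧
      aeval (fun k => (inl (A k.1 k.2) + inr (Y k.1 k.2) : DualNumber ℂ)) g ≠ 0 := by
  obtain ⟨w, hw⟩ := exists_linearIndependent_sylvester A
  generalize adRank A = r at w hw
  let f : Fin (r + 1) → Matrix (Fin n) (Fin n) ℂ := Fin.cons Y fun i => sylvester A A (w i)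
  have hf : LinearIndependent ℂ f := by
    refine linearIndependent_finCons.2 ⟨hw, fun h => hY (Submodule.span_le.2 ?_ h)⟩
    rintro _ ⟨i, rfl⟩
    exact ⟨w i, rfl⟩
  obtain ⟨P, hP⟩ := hf.exists_dual_family
  have hP0 : P Y = Pi.single 0 1 := hP 0
  have hPs : ∀ i : Fin r, P (sylvester A A (w i)) = Pi.single i.succ 1 := fun i => hP i.succ
  -- At `B = A + ε Y` the matrix `1` is sent to `-ε Y`, so the first column is of pure first order.
  -- The other columns reduce to the `sylvester A A (w i)`; in the coordinates `P` the minor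
  -- therefore equals `-ε`.
  let q : Fin (r + 1) → Matrix (Fin n) (Fin n) ℂ := Fin.cons 1 w
  refine ⟨(sylvesterMatrix A q P (Matrix.of fun a b =>
    (X (a, b) : MvPolynomial (Fin n × Fin n) ℂ))).det, fun B hB => ?_, ?_⟩
  · rw [aeval_det_sylvesterMatrix]
    exact det_sylvesterMatrix_eq_zero A q P _ (Nat.lt_succ_of_le hB)
  · rw [aeval_det_sylvesterMatrix]
    set G := sylvesterMatrix A q P
      (Matrix.of fun a b => (inl (A a b) + inr (Y a b) : DualNumber ℂ)) with hG
    have hcol : ∀ i, G i 0 = -inr (P Y i) := sylvesterMatrix_dualNumber A q P Y rfl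
    rw [Matrix.det_succ_column_zero, Finset.sum_eq_single 0]
    · have h2 : fst (G.submatrix (Fin.succAbove 0) Fin.succ).det = 1 := by
        refine ((fstHom ℂ ℂ ℂ).map_det _).trans ?_
        rw [← Matrix.det_one (n := Fin r)]
        congr 1
        ext i j
        have h3 : (Matrix.of fun a b => (inl (A a b) + inr (Y a b) : DualNumber ℂ)).map fst = A := by
          ext; simp
        have h4 : fst (G i.succ j.succ) = (1 : Matrix (Fin r) (Fin r) ℂ) i j := by
          rw [hG, fst_sylvesterMatrix, h3]
          have : q j.succ = w j := rfl
          rw [this, hPs]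
          simp [Matrix.one_apply, Pi.single_apply]
        simpa using h4
      rw [hcol, hP0]
      intro h
      have := congrArg snd h
      rw [Fin.val_zero, pow_zero, one_mul, Pi.single_eq_same, neg_mul, snd_neg, snd_mul, fst_inr,
        zero_smul, h2, snd_inr] at this
      simp at this
    · intro i _ hi
      rw [hcol, hP0, Pi.single_eq_of_ne hi]; simp
    · simp

/-! ### Rational charts of a conjugacy class. -/

section Parametrization

variable {n r : ℕ} {R : Type} [CommRing R] [Algebra ℂ R]

/-- `1 + ∑ i, t i • w i`. -/
def affineComb (w : Fin r → Matrix (Fin n) (Fin n) ℂ) (t : Fin r → R) : Matrix (Fin n) (Fin n) R :=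
  1 + ∑ i, t i • (w i).map (algebraMap ℂ R)

/-- The numerator of the conjugate of `A` by `affineComb w t`. -/
def conjNum (A : Matrix (Fin n) (Fin n) ℂ) (w : Fin r → Matrix (Fin n) (Fin n) ℂ) (t : Fin r → R) :
    Matrix (Fin n) (Fin n) R :=
  affineComb w t * A.map (algebraMap ℂ R) * (affineComb w t).adjugate

/-- The denominator of the conjugate of `A` by `affineComb w t`. -/
def conjDen (w : Fin r → Matrix (Fin n) (Fin n) ℂ) (t : Fin r → R) : R :=
  (affineComb w t).det

theorem map_affineComb {R' : Type} [CommRing R'] [Algebra ℂ R'] (ψ : R →ₐ[ℂ] R')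
    (w : Fin r → Matrix (Fin n) (Fin n) ℂ) (t : Fin r → R) :
    ψ.mapMatrix (affineComb w t) = affineComb w (fun i => ψ (t i)) := by
  ext a b
  simp [affineComb, Matrix.sum_apply, Matrix.one_apply, apply_ite ψ]

theorem map_conjNum {R' : Type} [CommRing R'] [Algebra ℂ R'] (ψ : R →ₐ[ℂ] R')
    (A : Matrix (Fin n) (Fin n) ℂ) (w : Fin r → Matrix (Fin n) (Fin n) ℂ) (t : Fin r → R)
    (a b : Fin n) : ψ (conjNum A w t a b) = conjNum A w (fun i => ψ (t i)) a b := by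
  have h : ψ.mapMatrix (A.map (algebraMap ℂ R)) = A.map (algebraMap ℂ R') := by ext; simp
  have : ψ.mapMatrix (conjNum A w t) = conjNum A w (fun i => ψ (t i)) := by
    rw [conjNum, map_mul, map_mul, AlgHom.map_adjugate, map_affineComb, h, conjNum]
  rw [← this]; rfl

theorem map_conjDen {R' : Type} [CommRing R'] [Algebra ℂ R'] (ψ : R →ₐ[ℂ] R')
    (w : Fin r → Matrix (Fin n) (Fin n) ℂ) (t : Fin r → R) :
    ψ (conjDen w t) = conjDen w (fun i => ψ (t i)) := by
  rw [conjDen, AlgHom.map_det, map_affineComb, conjDen]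

theorem affineComb_zero (w : Fin r → Matrix (Fin n) (Fin n) ℂ) :
    affineComb w (0 : Fin r → ℂ) = 1 := by simp [affineComb]

theorem conjDen_zero (w : Fin r → Matrix (Fin n) (Fin n) ℂ) : conjDen w (0 : Fin r → ℂ) = 1 := by
  simp [conjDen, affineComb_zero]

theorem conjNum_zero (A : Matrix (Fin n) (Fin n) ℂ) (w : Fin r → Matrix (Fin n) (Fin n) ℂ) :
    conjNum A w (0 : Fin r → ℂ) = A := by
  simp [conjNum, affineComb_zero]

theorem exists_conj_eq_conjNum_div_conjDen (A : GL (Fin n) ℂ)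
    (w : Fin r → Matrix (Fin n) (Fin n) ℂ) (t : Fin r → ℂ) (ht : conjDen w t ≠ 0) :
    ∃ B : GL (Fin n) ℂ, IsConj A B ∧
      ∀ a b, (B : Matrix (Fin n) (Fin n) ℂ) a b =
        conjNum (A : Matrix (Fin n) (Fin n) ℂ) w t a b / conjDen w t := by
  let g : GL (Fin n) ℂ := Matrix.GeneralLinearGroup.mkOfDetNeZero (affineComb w t) ht
  refine ⟨g * A * g⁻¹, isConj_iff.2 ⟨g, rfl⟩, fun a b => ?_⟩
  have h1 : ((g⁻¹ : GL (Fin n) ℂ) : Matrix (Fin n) (Fin n) ℂ) =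
      (conjDen w t)⁻¹ • (affineComb w t).adjugate := by
    rw [Matrix.coe_units_inv, Matrix.inv_def, Ring.inverse_eq_inv']
    rfl
  have h2 : (A : Matrix (Fin n) (Fin n) ℂ).map (algebraMap ℂ ℂ) = A := by ext; simp
  have h3 : ((g * A * g⁻¹ : GL (Fin n) ℂ) : Matrix (Fin n) (Fin n) ℂ) =
      (conjDen w t)⁻¹ • conjNum (A : Matrix (Fin n) (Fin n) ℂ) w t := by
    rw [Units.val_mul, Units.val_mul, h1, conjNum, h2, Matrix.mul_smul]
    rfl
  rw [h3, Matrix.smul_apply, smul_eq_mul, div_eq_inv_mul]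

/-- Conjugation by `1 + ε V`, whose inverse is `1 - ε V`, changes `A` by `-ε (A V - V A)`. If the
first-order change vanishes, `V` commutes with `A`. This makes the charts immersive. -/
theorem commute_of_conjNum_eq (A : Matrix (Fin n) (Fin n) ℂ)
    (w : Fin r → Matrix (Fin n) (Fin n) ℂ) (v : Fin r → ℂ)
    (h : ∀ a b, conjNum A w (fun i => (inr (v i) : DualNumber ℂ)) a b =
      inl (A a b) * conjDen w (fun i => (inr (v i) : DualNumber ℂ))) :
    ∑ i, v i • sylvester A A (w i) = 0 := by
  set V : Matrix (Fin n) (Fin n) ℂ := ∑ i, v i • w i with hV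
  set t : Fin r → DualNumber ℂ := fun i => inr (v i)
  let W : Matrix (Fin n) (Fin n) (DualNumber ℂ) := V.map inr
  let A' : Matrix (Fin n) (Fin n) (DualNumber ℂ) := A.map (algebraMap ℂ _)
  have hW : affineComb w t = 1 + W := by
    rw [affineComb]
    congr 1
    ext a b <;> simp [W, t, hV, Matrix.sum_apply, algebraMap_eq_inl, fst_sum, snd_sum]
  have hWW : W * W = 0 := by
    ext a b <;> simp [W, Matrix.mul_apply]
  have hWAW : W * A' * W = 0 := by
    ext a b <;> simp [W, A', Matrix.mul_apply, fst_sum, snd_sum]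
  have hinv : (1 + W) * (1 - W) = 1 := by
    rw [add_mul, mul_sub, mul_sub, hWW]; simp
  have hadj : (1 + W).adjugate = (1 + W).det • (1 - W) := by
    calc (1 + W).adjugate = (1 + W).adjugate * ((1 + W) * (1 - W)) := by rw [hinv, mul_one]
      _ = _ := by rw [← mul_assoc, Matrix.adjugate_mul, Matrix.smul_mul, one_mul]
  have h1 : conjNum A w t = conjDen w t • A' := by
    ext1 a b
    rw [h a b, mul_comm]
    simp [A', algebraMap_eq_inl]
  rw [conjNum, conjDen, hW, hadj, Matrix.mul_smul] at h1
  have hu : IsUnit (1 + W).det := by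
    refine IsUnit.of_mul_eq_one ((1 - W).det) ?_
    rw [← Matrix.det_mul, hinv, Matrix.det_one]
  have h2 : (1 + W) * A' * (1 - W) = A' := (hu.smul_left_cancel).1 h1
  have h3 : A' * W - W * A' = 0 := by
    have : (1 + W) * A' * (1 - W) = A' - (A' * W - W * A') - W * A' * W := by noncomm_ring
    rw [this, hWAW, sub_zero, sub_eq_self] at h2
    exact h2
  have h4 : sylvester A A V = 0 := by
    ext a b
    have := congrArg snd (congrFun (congrFun h3 a) b)
    simpa [A', W, Matrix.mul_apply, algebraMap_eq_inl, snd_sum, sylvester_apply, mul_comm] using this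
  rw [← h4, hV]; simp

end Parametrization

end

/-! ### Tangent space and dimension of a conjugacy class. -/

noncomputable section

open MvPolynomial TrivSqZeroExt

theorem isConj_of_mem_carrier {G : Type*} [Monoid G] {c : ConjClasses G} {a b : G}
    (ha : a ∈ c.carrier) (hb : b ∈ c.carrier) : IsConj a b := by
  rw [ConjClasses.mem_carrier_iff_mk_eq] at ha hb
  rw [← ConjClasses.mk_eq_mk_iff_isConj, ha, hb]

theorem mem_carrier_of_isConj {G : Type*} [Monoid G] {c : ConjClasses G} {a b : G}
    (ha : a ∈ c.carrier) (hb : IsConj a b) : b ∈ c.carrier := by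
  rw [ConjClasses.mem_carrier_iff_mk_eq] at ha ⊢
  rw [← ha, ConjClasses.mk_eq_mk_iff_isConj]
  exact hb.symm

theorem finrank_range_sylvester_le_of_isConj {n : ℕ} {A B : GL (Fin n) ℂ} (h : IsConj A B) :
    Module.finrank ℂ (LinearMap.range (sylvester (A : Matrix (Fin n) (Fin n) ℂ) B)) ≤
      adRank (A : Matrix (Fin n) (Fin n) ℂ) := by
  obtain ⟨g, rfl⟩ := isConj_iff.1 h
  have := finrank_range_sylvester_conj_le (A := (A : Matrix (Fin n) (Fin n) ℂ)) (mul_one 1)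
    g.mul_inv
  rwa [one_mul, mul_one] at this

theorem adRank_eq_of_isConj {n : ℕ} {A B : GL (Fin n) ℂ} (h : IsConj A B) :
    adRank (A : Matrix (Fin n) (Fin n) ℂ) = adRank (B : Matrix (Fin n) (Fin n) ℂ) := by
  have key : ∀ {A B : GL (Fin n) ℂ}, IsConj A B →
      adRank (B : Matrix (Fin n) (Fin n) ℂ) ≤ adRank (A : Matrix (Fin n) (Fin n) ℂ) := by
    intro A B h
    obtain ⟨g, rfl⟩ := isConj_iff.1 h
    exact finrank_range_sylvester_conj_le (A := (A : Matrix (Fin n) (Fin n) ℂ)) g.mul_inv g.mul_inv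
  exact le_antisymm (key h.symm) (key h)

/-- Every `B` in the class satisfies the rank bound on `Z ↦ A Z - Z B`, so the separating minor
vanishes on the class. Phrasing the hypothesis with dual numbers makes it apply also to one
component of a tangent vector to the tuple variety. -/
theorem mem_range_sylvester_of_dualNumber {n : ℕ} (c : ConjClasses (GL (Fin n) ℂ))
    {A : GL (Fin n) ℂ} (hA : A ∈ c.carrier) (Y : Matrix (Fin n) (Fin n) ℂ)
    (hY : ∀ g ∈ vanishingIdeal ℂ (conjClassVariety c),
      aeval (fun k => (inl ((A : Matrix (Fin n) (Fin n) ℂ) k.1 k.2) + inr (Y k.1 k.2) :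
        DualNumber ℂ)) g = 0) :
    Y ∈ LinearMap.range (sylvester (A : Matrix (Fin n) (Fin n) ℂ) A) := by
  by_contra h
  obtain ⟨g, hg, hne⟩ := exists_separating_polynomial _ Y h
  refine hne (hY g ?_)
  rintro _ ⟨B, hB, rfl⟩
  exact hg _ (finrank_range_sylvester_le_of_isConj (isConj_of_mem_carrier hA hB))

theorem eq_zero_of_mem_tangentSpace_conj {n r : ℕ} {τ : Type} [Fintype τ] (κ : Fin r → τ)
    (A : Matrix (Fin n) (Fin n) ℂ) (w : Fin r → Matrix (Fin n) (Fin n) ℂ)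
    (hw : LinearIndependent ℂ fun i => sylvester A A (w i))
    {I : Ideal (MvPolynomial τ ℂ)} (hI : I ≤ vanishingIdeal ℂ {(0 : τ → ℂ)})
    (hmem : ∀ a b, conjNum A w (fun i => (X (κ i) : MvPolynomial τ ℂ)) a b -
      C (A a b) * conjDen w (fun i => (X (κ i) : MvPolynomial τ ℂ)) ∈ I)
    {v : τ → ℂ} (hv : v ∈ tangentSpace I 0) (i : Fin r) : v (κ i) = 0 := by
  refine Fintype.linearIndependent_iff.1 hw (fun i => v (κ i))
    (commute_of_conjNum_eq A w (fun i => v (κ i)) fun a b => ?_) i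
  have := aeval_dualNumber_eq_zero hI hv (hmem a b)
  rw [map_sub, map_mul, map_conjNum, map_conjDen, sub_eq_zero] at this
  simpa [algebraMap_eq_inl] using this

theorem entries_mem_conjClassVariety {n : ℕ} {c : ConjClasses (GL (Fin n) ℂ)}
    {A : GL (Fin n) ℂ} (hA : A ∈ c.carrier) : entries A ∈ conjClassVariety c :=
  ⟨A, hA, rfl⟩

theorem finrank_tangentSpace_conjClassVariety_le {n : ℕ} (c : ConjClasses (GL (Fin n) ℂ))
    {A : GL (Fin n) ℂ} (hA : A ∈ c.carrier) :
    Module.finrank ℂ (tangentSpace (vanishingIdeal ℂ (conjClassVariety c)) (entries A)) ≤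
      adRank (A : Matrix (Fin n) (Fin n) ℂ) := by
  let e : (Fin n × Fin n → ℂ) ≃ₗ[ℂ] Matrix (Fin n) (Fin n) ℂ := LinearEquiv.curry ℂ ℂ (Fin n) (Fin n)
  rw [← LinearEquiv.finrank_map_eq e]
  apply Submodule.finrank_mono
  rintro _ ⟨v, hv, rfl⟩
  refine mem_range_sylvester_of_dualNumber c hA _ fun g hg => ?_
  exact aeval_dualNumber_eq_zero
    (vanishingIdeal_anti_mono (Set.singleton_subset_iff.2 (entries_mem_conjClassVariety hA))) hv hg

theorem adRank_le_varietyDimAt_conjClassVariety {n : ℕ} (c : ConjClasses (GL (Fin n) ℂ))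
    {A : GL (Fin n) ℂ} (hA : A ∈ c.carrier) :
    (adRank (A : Matrix (Fin n) (Fin n) ℂ) : WithBot ℕ∞) ≤
      varietyDimAt (conjClassVariety c) (entries A) := by
  obtain ⟨w, hw⟩ := exists_linearIndependent_sylvester (A : Matrix (Fin n) (Fin n) ℂ)
  generalize adRank (A : Matrix (Fin n) (Fin n) ℂ) = r at w hw
  let N : Fin n × Fin n → MvPolynomial (Fin r) ℂ := fun k =>
    conjNum (A : Matrix (Fin n) (Fin n) ℂ) w (fun i => X i) k.1 k.2
  let D : MvPolynomial (Fin r) ℂ := conjDen w (fun i => X i)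
  have hN : ∀ t k, eval t (N k) = conjNum (A : Matrix (Fin n) (Fin n) ℂ) w t k.1 k.2 := by
    intro t k
    rw [← aeval_apply_eq_eval, map_conjNum]
    simp
  have hD : ∀ t, eval t D = conjDen w t := by
    intro t
    rw [← aeval_apply_eq_eval, map_conjDen]
    simp
  have := card_le_varietyDimAt_add_card (κ := Empty) (conjClassVariety c) (entries A) N (fun _ => D)
    Empty.elim (fun _ => by rw [hD, conjDen_zero]; exact one_ne_zero)
    (fun k => by rw [hN, hD, conjDen_zero, conjNum_zero, mul_one]; rfl) (fun i => i.elim)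
    (fun t ht _ => ?_) ?_
  · simpa using this
  -- For `n = 0` there are no entries and `ht` says nothing, but the affine space is a single point.
  · rcases isEmpty_or_nonempty (Fin n × Fin n) with hn | ⟨⟨k⟩⟩
    · exact ⟨A, hA, Subsingleton.elim _ _⟩
    · have h1 := ht k
      rw [hD] at h1
      obtain ⟨B, hB, hBe⟩ := exists_conj_eq_conjNum_div_conjDen A w t h1
      refine ⟨B, mem_carrier_of_isConj hA hB, ?_⟩
      ext k
      rw [hN, hD, ← hBe]
      rfl
  · rw [eq_bot_iff]
    intro v hv
    rw [Submodule.mem_bot]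
    ext i
    refine eq_zero_of_mem_tangentSpace_conj id (A : Matrix (Fin n) (Fin n) ℂ) w hw ?_
      (fun a b => Ideal.subset_span (Set.mem_range_self (a, b))) hv i
    rw [Ideal.span_le]
    rintro _ ⟨k, rfl⟩
    show _ ∈ vanishingIdeal ℂ {(0 : Fin r → ℂ)}
    rw [mem_vanishingIdeal_singleton_iff, aeval_apply_eq_eval, map_sub, map_mul, hN, hD, eval_C,
      conjDen_zero, conjNum_zero, mul_one, sub_eq_zero]
    rfl

theorem varietyDimAt_conjClassVariety {n : ℕ} (c : ConjClasses (GL (Fin n) ℂ))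
    {A : GL (Fin n) ℂ} (hA : A ∈ c.carrier) :
    varietyDimAt (conjClassVariety c) (entries A) = adRank (A : Matrix (Fin n) (Fin n) ℂ) :=
  le_antisymm ((varietyDimAt_le_finrank_tangentSpace (entries_mem_conjClassVariety hA)).trans
    (by exact_mod_cast finrank_tangentSpace_conjClassVariety_le c hA))
    (adRank_le_varietyDimAt_conjClassVariety c hA)

theorem varietyDim_conjClassVariety {n : ℕ} (c : ConjClasses (GL (Fin n) ℂ))
    {A : GL (Fin n) ℂ} (hA : A ∈ c.carrier) :
    varietyDim (conjClassVariety c) = adRank (A : Matrix (Fin n) (Fin n) ℂ) := by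
  apply le_antisymm
  · refine iSup₂_le ?_
    rintro _ ⟨B, hB, rfl⟩
    rw [varietyDimAt_conjClassVariety c hB, adRank_eq_of_isConj (isConj_of_mem_carrier hA hB)]
  · rw [← varietyDimAt_conjClassVariety c hA]
    exact le_iSup₂ (f := fun x _ => varietyDimAt (conjClassVariety c) x) (entries A) ⟨A, hA, rfl⟩

end

/-! ### The derivative of the product map and its corank. -/

noncomputable section

open MvPolynomial TrivSqZeroExt

section ProductDerivative

variable {n q : ℕ}

theorem Matrix.map_fst_mul (A B : Matrix (Fin n) (Fin n) (DualNumber ℂ)) :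
    (A * B).map fst = A.map fst * B.map fst := by
  ext; simp [Matrix.mul_apply, fst_sum]

theorem Matrix.map_snd_mul (A B : Matrix (Fin n) (Fin n) (DualNumber ℂ)) :
    (A * B).map snd = A.map fst * B.map snd + A.map snd * B.map fst := by
  ext; simp [Matrix.mul_apply, snd_sum, Finset.sum_add_distrib, mul_comm]

/-- The matrices `M j + ε X j`. -/
def firstOrderTuple (M : Fin q → GL (Fin n) ℂ) (X : Fin q → Matrix (Fin n) (Fin n) ℂ) :
    Fin q → Matrix (Fin n) (Fin n) (DualNumber ℂ) := fun j =>
  Matrix.of fun a b => inl ((M j : Matrix (Fin n) (Fin n) ℂ) a b) + inr (X j a b)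

/-- Conjugation by `M 0 * ⋯ * M (j - 1)` of `X * (M j)⁻¹`, as a linear map of `X`. -/
def conjTerm (M : Fin q → GL (Fin n) ℂ) (j : Fin q) :
    Matrix (Fin n) (Fin n) ℂ →ₗ[ℂ] Matrix (Fin n) (Fin n) ℂ :=
  LinearMap.mulLeft ℂ (Fin.partialProd M j.castSucc).val ∘ₗ
    LinearMap.mulRight ℂ ((Fin.partialProd M j.succ)⁻¹).val

theorem conjTerm_apply (M : Fin q → GL (Fin n) ℂ) (j : Fin q) (X : Matrix (Fin n) (Fin n) ℂ) :
    conjTerm M j X = (Fin.partialProd M j.castSucc).val *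
      (X * ((Fin.partialProd M j.succ)⁻¹).val) := rfl

/-- The Leibniz rule. Factoring the partial product out on the right makes the term of index `j`
independent of `k`, so passing from `k` to `k + 1` only adds a summand. -/
theorem partialProd_firstOrderTuple (M : Fin q → GL (Fin n) ℂ)
    (X : Fin q → Matrix (Fin n) (Fin n) ℂ) (k : Fin (q + 1)) :
    (Fin.partialProd (firstOrderTuple M X) k).map fst = (Fin.partialProd M k).val ∧
    (Fin.partialProd (firstOrderTuple M X) k).map snd =
      (∑ j with j.castSucc < k, conjTerm M j (X j)) * (Fin.partialProd M k).val := by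
  induction k using Fin.induction with
  | zero =>
    constructor
    · ext a b; simp [Matrix.one_apply, apply_ite fst]
    · ext a b; simp [Matrix.one_apply, apply_ite snd]
  | succ i ih =>
    obtain ⟨h1, h2⟩ := ih
    have h3 : (firstOrderTuple M X i).map fst = M i := by ext; simp [firstOrderTuple]
    have h4 : (firstOrderTuple M X i).map snd = X i := by ext; simp [firstOrderTuple]
    have h5 : (Finset.univ.filter fun j : Fin q => j.castSucc < i.succ) =
        insert i (Finset.univ.filter fun j : Fin q => j.castSucc < i.castSucc) := by
      ext j
      simp only [Finset.mem_filter, Finset.mem_univ, true_and, Finset.mem_insert, Fin.lt_def,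
        Fin.ext_iff, Fin.val_castSucc, Fin.val_succ]
      omega
    rw [Fin.partialProd_succ, Matrix.map_fst_mul, Matrix.map_snd_mul, h1, h2, h3, h4]
    refine ⟨by rw [Fin.partialProd_succ, Units.val_mul], ?_⟩
    rw [h5, Finset.sum_insert (by simp), add_mul, conjTerm_apply]
    congr 1
    · rw [mul_assoc, mul_assoc, Units.inv_mul, mul_one]
    · rw [Fin.partialProd_succ, Units.val_mul, mul_assoc]

theorem partialProd_last_eq {α : Type*} [Monoid α] (f : Fin q → α) :
    Fin.partialProd f (Fin.last q) = (List.ofFn f).prod := by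
  rw [Fin.partialProd, List.take_of_length_le (by simp)]

theorem sum_conjTerm_eq_zero (M : Fin q → GL (Fin n) ℂ) (X : Fin q → Matrix (Fin n) (Fin n) ℂ)
    (hM : (List.ofFn M).prod = 1) (hX : (List.ofFn (firstOrderTuple M X)).prod = 1) :
    ∑ j, conjTerm M j (X j) = 0 := by
  have := (partialProd_firstOrderTuple M X (Fin.last q)).2
  rw [partialProd_last_eq, partialProd_last_eq, hM, hX] at this
  simp only [Fin.castSucc_lt_last, Finset.filter_true, Units.val_one, mul_one] at this
  rw [← this]
  ext a b; simp [Matrix.one_apply, apply_ite snd]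

/-- The derivative of the product map on the product of the tangent spaces of the orbits. -/
def productDerivative (M : Fin q → GL (Fin n) ℂ) :
    (∀ j, LinearMap.range (sylvester (M j : Matrix (Fin n) (Fin n) ℂ) (M j))) →ₗ[ℂ]
      Matrix (Fin n) (Fin n) ℂ :=
  ∑ j, conjTerm M j ∘ₗ Submodule.subtype _ ∘ₗ LinearMap.proj j

theorem productDerivative_apply (M : Fin q → GL (Fin n) ℂ)
    (X : ∀ j, LinearMap.range (sylvester (M j : Matrix (Fin n) (Fin n) ℂ) (M j))) :
    productDerivative M X = ∑ j, conjTerm M j (X j) := by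
  simp [productDerivative]

theorem conjTerm_mem_range_productDerivative (M : Fin q → GL (Fin n) ℂ) (j : Fin q)
    (Z : Matrix (Fin n) (Fin n) ℂ) :
    conjTerm M j (sylvester (M j : Matrix (Fin n) (Fin n) ℂ) (M j) Z) ∈
      LinearMap.range (productDerivative M) := by
  classical
  refine ⟨Pi.single j ⟨_, Z, rfl⟩, ?_⟩
  rw [productDerivative_apply, Finset.sum_eq_single j]
  · simp
  · intro i _ hi
    rw [Pi.single_eq_of_ne hi]; simp
  · simp

/-- Induction along the partial products: once `Z` commutes with `M_0 ⋯ M_{j-1}`, this factor drops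
out of the trace condition at `j`. Nondegeneracy of the trace form then gives commutation with
`M_j`, hence with the next partial product. -/
theorem commute_of_trace_eq_zero (M : Fin q → GL (Fin n) ℂ) (Z : Matrix (Fin n) (Fin n) ℂ)
    (hZ : ∀ Y ∈ LinearMap.range (productDerivative M), (Z * Y).trace = 0) (j : Fin q) :
    Z * (M j : Matrix (Fin n) (Fin n) ℂ) = (M j : Matrix (Fin n) (Fin n) ℂ) * Z := by
  have step : ∀ j : Fin q,
      Z * (Fin.partialProd M j.castSucc).val =
        (Fin.partialProd M j.castSucc).val * Z →
      Z * (M j : Matrix (Fin n) (Fin n) ℂ) = (M j : Matrix (Fin n) (Fin n) ℂ) * Z := by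
    intro j hj
    set P : GL (Fin n) ℂ := Fin.partialProd M j.castSucc with hP
    rw [eq_comm, ← sub_eq_zero]
    have key : ∀ B : Matrix (Fin n) (Fin n) ℂ,
        (((M j : Matrix (Fin n) (Fin n) ℂ) * Z - Z * (M j : Matrix (Fin n) (Fin n) ℂ)) * B).trace = 0 := by
      intro B
      -- The test vector `B * M j` is chosen so that its commutator with `M j`, multiplied by `(M
      -- j)⁻¹`, is `M j * B - B * M j`.
      have h1 := hZ _ (conjTerm_mem_range_productDerivative M j (B * M j))
      rw [conjTerm_apply, ← hP, Fin.partialProd_succ, ← hP, mul_inv_rev, Units.val_mul,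
        ← mul_assoc, ← mul_assoc, Matrix.trace_mul_comm, hj, mul_assoc, mul_assoc,
        Units.inv_mul_cancel_left] at h1
      have h2 : sylvester (M j : Matrix (Fin n) (Fin n) ℂ) (M j) (B * M j) *
          (((M j)⁻¹ : GL (Fin n) ℂ) : Matrix (Fin n) (Fin n) ℂ) = M j * B - B * M j := by
        rw [sylvester_apply, sub_mul, ← mul_assoc, Units.mul_inv_cancel_right,
          Units.mul_inv_cancel_right]
      rw [Matrix.trace_mul_comm, mul_assoc, h2, mul_sub, Matrix.trace_sub,
        ← mul_assoc, ← mul_assoc, sub_eq_zero] at h1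
      rw [sub_mul, Matrix.trace_sub, sub_eq_zero, h1, Matrix.trace_mul_comm (Z * B), ← mul_assoc]
    ext a b
    have := key (Matrix.single b a 1)
    simpa [Matrix.trace_mul_single] using this
  have all : ∀ k : Fin (q + 1), Z * (Fin.partialProd M k).val =
        (Fin.partialProd M k).val * Z := by
    intro k
    induction k using Fin.induction with
    | zero => simp
    | succ i ih =>
      rw [Fin.partialProd_succ, Units.val_mul, ← mul_assoc, ih, mul_assoc, step i ih, mul_assoc]
  exact step j (all _)

/-- Rank-nullity for the trace pairing against the image: its kernel consists of matrices commuting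
with the whole tuple, hence of scalars. -/
theorem sq_le_finrank_range_productDerivative (M : Fin q → GL (Fin n) ℂ)
    (hM : HasTrivialCentralizer M) :
    n ^ 2 ≤ Module.finrank ℂ (LinearMap.range (productDerivative M)) + 1 := by
  let W := LinearMap.range (productDerivative M)
  let Θ : Matrix (Fin n) (Fin n) ℂ →ₗ[ℂ] Module.Dual ℂ W :=
    (Submodule.subtype W).dualMap ∘ₗ
      (LinearMap.compRight ℂ (Matrix.traceLinearMap (Fin n) ℂ ℂ) ∘ₗ LinearMap.mul ℂ _)
  have hΘ : ∀ Z (Y : W), Θ Z Y = (Z * (Y : Matrix (Fin n) (Fin n) ℂ)).trace := fun Z Y => rfl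
  have h1 := Θ.finrank_range_add_finrank_ker
  have h2 : Module.finrank ℂ (LinearMap.range Θ) ≤ Module.finrank ℂ W := by
    refine (Submodule.finrank_le _).trans ?_
    rw [Subspace.dual_finrank_eq]
  have h3 : LinearMap.ker Θ ≤ Submodule.span ℂ {1} := by
    intro Z hZ
    obtain ⟨c, hc⟩ := hM Z (commute_of_trace_eq_zero M Z fun Y hY => by
      have := LinearMap.congr_fun (LinearMap.mem_ker.1 hZ) ⟨Y, hY⟩
      rwa [hΘ] at this)
    exact Submodule.mem_span_singleton.2 ⟨c, hc.symm⟩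
  have h4 : Module.finrank ℂ (LinearMap.ker Θ) ≤ 1 :=
    (Submodule.finrank_mono h3).trans (by
      simpa using finrank_span_le_card (R := ℂ) ({1} : Set (Matrix (Fin n) (Fin n) ℂ)))
  have h5 : Module.finrank ℂ (Matrix (Fin n) (Fin n) ℂ) = n ^ 2 := by
    rw [Module.finrank_matrix]; simp [pow_two]
  change n ^ 2 ≤ Module.finrank ℂ W + 1
  omega

end ProductDerivative

end

/-! ### The tuple variety: tangent space bound and dimension bound. -/

noncomputable section

open MvPolynomial TrivSqZeroExt

theorem tupleEntries_mem_tupleVariety {n q : ℕ} {C : Fin q → ConjClasses (GL (Fin n) ℂ)}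
    {M : Fin q → GL (Fin n) ℂ} (hC : ∀ j, M j ∈ (C j).carrier) (hprod : (List.ofFn M).prod = 1) :
    tupleEntries M ∈ tupleVariety C :=
  ⟨M, ⟨hC, hprod⟩, rfl⟩

theorem map_list_prod_ofFn_val {n q : ℕ} (M : Fin q → GL (Fin n) ℂ) :
    (List.ofFn fun j => (M j : Matrix (Fin n) (Fin n) ℂ)).prod = ((List.ofFn M).prod).val := by
  have := map_list_prod (Units.coeHom (Matrix (Fin n) (Fin n) ℂ)) (List.ofFn M)
  rw [List.map_ofFn] at this
  exact this.symm

theorem aeval_prod_generic {n q : ℕ} {E : Type} [CommRing E] [Algebra ℂ E]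
    (u : Fin q × Fin n × Fin n → E) (a b : Fin n) :
    aeval u ((List.ofFn fun j => (Matrix.of fun a b => X (j, a, b) :
      Matrix (Fin n) (Fin n) (MvPolynomial (Fin q × Fin n × Fin n) ℂ))).prod a b) =
    (List.ofFn fun j => (Matrix.of fun a b => u (j, a, b) : Matrix (Fin n) (Fin n) E)).prod a b := by
  have := map_list_prod (aeval u : MvPolynomial (Fin q × Fin n × Fin n) ℂ →ₐ[ℂ] E).mapMatrix
    (List.ofFn fun j => (Matrix.of fun a b => X (j, a, b) :
      Matrix (Fin n) (Fin n) (MvPolynomial (Fin q × Fin n × Fin n) ℂ)))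
  rw [List.map_ofFn] at this
  refine (congrFun (congrFun this a) b).trans ?_
  have h : (⇑(aeval u : MvPolynomial (Fin q × Fin n × Fin n) ℂ →ₐ[ℂ] E).mapMatrix ∘
      fun j => (Matrix.of fun a b => X (j, a, b) :
        Matrix (Fin n) (Fin n) (MvPolynomial (Fin q × Fin n × Fin n) ℂ))) =
      fun j => Matrix.of fun a b => u (j, a, b) := by
    ext j a b
    simp
  rw [h]

theorem finrank_tangentSpace_tupleVariety_add_sq_le {n q : ℕ}
    (C : Fin q → ConjClasses (GL (Fin n) ℂ)) (M : Fin q → GL (Fin n) ℂ)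
    (hC : ∀ j, M j ∈ (C j).carrier) (hprod : (List.ofFn M).prod = 1)
    (hM : HasTrivialCentralizer M) :
    Module.finrank ℂ (tangentSpace (vanishingIdeal ℂ (tupleVariety C)) (tupleEntries M)) + n ^ 2 ≤
      (∑ j, adRank (M j : Matrix (Fin n) (Fin n) ℂ)) + 1 := by
  let T := tangentSpace (vanishingIdeal ℂ (tupleVariety C)) (tupleEntries M)
  have hle : vanishingIdeal ℂ (tupleVariety C) ≤ vanishingIdeal ℂ {tupleEntries M} :=
    vanishingIdeal_anti_mono
      (Set.singleton_subset_iff.2 (tupleEntries_mem_tupleVariety hC hprod))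
  let comp (j : Fin q) : (Fin q × Fin n × Fin n → ℂ) →ₗ[ℂ] Matrix (Fin n) (Fin n) ℂ :=
    { toFun := fun v => Matrix.of fun a b => v (j, a, b)
      map_add' := fun _ _ => rfl
      map_smul' := fun _ _ => rfl }
  have hrange : ∀ j (v : T), comp j v ∈
      LinearMap.range (sylvester (M j : Matrix (Fin n) (Fin n) ℂ) (M j)) := by
    intro j v
    refine mem_range_sylvester_of_dualNumber (C j) (hC j) _ fun g hg => ?_
    -- An equation of `C j`, read in the `j`-th block of coordinates, is an equation of the tuple
    -- variety.
    have h1 : rename (Prod.mk j) g ∈ vanishingIdeal ℂ (tupleVariety C) := by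
      rintro _ ⟨B, ⟨hB, -⟩, rfl⟩
      rw [aeval_rename]
      exact hg _ (entries_mem_conjClassVariety (hB j))
    have h2 := aeval_dualNumber_eq_zero hle v.2 h1
    rw [aeval_rename] at h2
    exact h2
  let L : T →ₗ[ℂ] (∀ j, LinearMap.range (sylvester (M j : Matrix (Fin n) (Fin n) ℂ) (M j))) :=
    LinearMap.pi fun j => LinearMap.codRestrict _ (comp j ∘ₗ T.subtype) (hrange j)
  have hL : Function.Injective L := by
    rw [← LinearMap.ker_eq_bot, eq_bot_iff]
    intro v hv
    rw [Submodule.mem_bot]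
    ext ⟨j, a, b⟩
    have := congrArg (fun Y => (Y j).1 a b) (LinearMap.mem_ker.1 hv)
    exact this
  have hker : ∀ v, L v ∈ LinearMap.ker (productDerivative M) := by
    intro v
    rw [LinearMap.mem_ker, productDerivative_apply]
    refine sum_conjTerm_eq_zero M (fun j => comp j v) hprod ?_
    ext1 a b
    -- An entry of the equation `M_1 ⋯ M_q = I`; its derivative along `v` puts `v` in the kernel of
    -- the product derivative.
    let g : MvPolynomial (Fin q × Fin n × Fin n) ℂ :=
      (List.ofFn fun j => (Matrix.of fun a b => X (j, a, b) :
        Matrix (Fin n) (Fin n) (MvPolynomial (Fin q × Fin n × Fin n) ℂ))).prod a b -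
      MvPolynomial.C ((1 : Matrix (Fin n) (Fin n) ℂ) a b)
    have h1 : g ∈ vanishingIdeal ℂ (tupleVariety C) := by
      rintro _ ⟨B, ⟨-, hB⟩, rfl⟩
      rw [map_sub, aeval_prod_generic, aeval_C, sub_eq_zero]
      refine (congrFun (congrFun (map_list_prod_ofFn_val B) a) b).trans ?_
      rw [hB]; rfl
    have h2 := aeval_dualNumber_eq_zero hle v.2 h1
    rw [map_sub, aeval_prod_generic, aeval_C, sub_eq_zero] at h2
    refine Eq.trans h2 ?_
    simp [Matrix.one_apply, apply_ite (algebraMap ℂ (DualNumber ℂ))]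
  have h1 : Module.finrank ℂ T ≤ Module.finrank ℂ (LinearMap.ker (productDerivative M)) :=
    LinearMap.finrank_le_finrank_of_injective (f := L.codRestrict _ hker) fun v w h =>
      hL (congrArg Subtype.val h)
  have h2 := (productDerivative M).finrank_range_add_finrank_ker
  have h3 := sq_le_finrank_range_productDerivative M hM
  rw [Module.finrank_pi_fintype] at h2
  change Module.finrank ℂ T + n ^ 2 ≤
    (∑ j, Module.finrank ℂ (LinearMap.range (sylvester (M j : Matrix (Fin n) (Fin n) ℂ) (M j)))) + 1
  omega

theorem list_prod_ofFn_smul {n q : ℕ} (c : Fin q → ℂ) (B : Fin q → Matrix (Fin n) (Fin n) ℂ) :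
    (List.ofFn fun j => c j • B j).prod = (∏ j, c j) • (List.ofFn B).prod := by
  induction q with
  | zero => simp
  | succ q ih =>
    rw [List.ofFn_succ, List.prod_cons, ih, List.ofFn_succ, List.prod_cons, Fin.prod_univ_succ,
      smul_mul_smul_comm]

/-- This saves one equation: a matrix agreeing with the identity off one diagonal entry is diagonal,
and that entry is its determinant. -/
theorem eq_one_of_det_eq_one {n : ℕ} (i₀ : Fin n) (Z : Matrix (Fin n) (Fin n) ℂ)
    (hZ : ∀ a b, (a, b) ≠ (i₀, i₀) → Z a b = (1 : Matrix (Fin n) (Fin n) ℂ) a b)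
    (hdet : Z.det = 1) : Z = 1 := by
  have h1 : Z = Matrix.diagonal (Function.update 1 i₀ (Z i₀ i₀)) := by
    ext a b
    by_cases hab : a = b
    · subst hab
      by_cases ha : a = i₀
      · subst ha; simp
      · rw [hZ a a (by simp [ha])]; simp [ha]
    · rw [hZ a b (by rintro ⟨⟩; exact hab rfl)]
      simp [hab]
  have h2 : Z i₀ i₀ = 1 := by
    rw [h1, Matrix.det_diagonal, Finset.prod_update_of_mem (Finset.mem_univ _)] at hdet
    simpa using hdet
  ext a b
  by_cases h : (a, b) = (i₀, i₀)
  · cases h; simpa using h2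
  · exact hZ a b h

theorem det_list_prod_ofFn_eq_of_isConj {n q : ℕ} {M B : Fin q → GL (Fin n) ℂ}
    (h : ∀ j, IsConj (M j) (B j)) :
    ((List.ofFn B).prod).val.det = ((List.ofFn M).prod).val.det := by
  have : Matrix.GeneralLinearGroup.det (List.ofFn B).prod =
      Matrix.GeneralLinearGroup.det (List.ofFn M).prod := by
    rw [map_list_prod, map_list_prod, List.map_ofFn, List.map_ofFn]
    congr 2
    ext1 j
    exact (isConj_iff_eq.1 (Matrix.GeneralLinearGroup.det.map_isConj (h j))).symm
  exact congrArg Units.val this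

theorem sum_le_varietyDimAt_tupleVariety {n q : ℕ} (hn : 1 ≤ n)
    (C : Fin q → ConjClasses (GL (Fin n) ℂ)) (M : Fin q → GL (Fin n) ℂ)
    (hC : ∀ j, M j ∈ (C j).carrier) (hprod : (List.ofFn M).prod = 1) (r : Fin q → ℕ)
    (w : ∀ j, Fin (r j) → Matrix (Fin n) (Fin n) ℂ)
    (hw : ∀ j, LinearIndependent ℂ fun i =>
      sylvester (M j : Matrix (Fin n) (Fin n) ℂ) (M j) (w j i)) :
    ((∑ j, r j : ℕ) : WithBot ℕ∞) ≤
      varietyDimAt (tupleVariety C) (tupleEntries M) + ((n ^ 2 - 1 : ℕ) : WithBot ℕ∞) := by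
  let i₀ : Fin n := ⟨0, hn⟩
  let τ := Σ j, Fin (r j)
  let N : Fin q → Matrix (Fin n) (Fin n) (MvPolynomial τ ℂ) := fun j =>
    conjNum (M j : Matrix (Fin n) (Fin n) ℂ) (w j) (fun i => X ⟨j, i⟩)
  let D : Fin q → MvPolynomial τ ℂ := fun j => conjDen (w j) (fun i => X ⟨j, i⟩)
  -- Product equals identity with denominators cleared, without the entry `(i₀, i₀)`, which the
  -- determinant recovers. This leaves `n ^ 2 - 1` equations.
  let F : {k : Fin n × Fin n // k ≠ (i₀, i₀)} → MvPolynomial τ ℂ := fun k =>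
    (List.ofFn N).prod k.1.1 k.1.2 -
      MvPolynomial.C ((1 : Matrix (Fin n) (Fin n) ℂ) k.1.1 k.1.2) * ∏ j, D j
  let t' (t : τ → ℂ) (j : Fin q) : Fin (r j) → ℂ := fun i => t ⟨j, i⟩
  have hN : ∀ t j a b, eval t (N j a b) =
      conjNum (M j : Matrix (Fin n) (Fin n) ℂ) (w j) (t' t j) a b := by
    intro t j a b
    rw [← aeval_apply_eq_eval, map_conjNum]
    simp [t']
  have hD : ∀ t j, eval t (D j) = conjDen (w j) (t' t j) := by
    intro t j
    rw [← aeval_apply_eq_eval, map_conjDen]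
    simp [t']
  have hF : ∀ t k, eval t (F k) =
      (List.ofFn fun j => conjNum (M j : Matrix (Fin n) (Fin n) ℂ) (w j) (t' t j)).prod k.1.1 k.1.2 -
        (1 : Matrix (Fin n) (Fin n) ℂ) k.1.1 k.1.2 * ∏ j, conjDen (w j) (t' t j) := by
    intro t k
    have h1 : eval t ((List.ofFn N).prod k.1.1 k.1.2) =
        ((List.ofFn N).map (eval t).mapMatrix).prod k.1.1 k.1.2 := by
      rw [← map_list_prod]; rfl
    have h2 : (⇑(eval t).mapMatrix ∘ N) =
        fun j => conjNum (M j : Matrix (Fin n) (Fin n) ℂ) (w j) (t' t j) := by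
      ext j a b
      exact hN t j a b
    rw [map_sub, map_mul, eval_C, map_prod, h1, List.map_ofFn, h2]
    simp only [hD]
  have hD0 : ∀ j, eval 0 (D j) = 1 := fun j => by rw [hD]; exact conjDen_zero (w j)
  have hN0 : ∀ j a b, eval 0 (N j a b) = (M j : Matrix (Fin n) (Fin n) ℂ) a b := fun j a b => by
    rw [hN]; exact congrFun (congrFun (conjNum_zero _ (w j)) a) b
  have main := card_le_varietyDimAt_add_card (tupleVariety C) (tupleEntries M)
    (fun k => N k.1 k.2.1 k.2.2) (fun k => D k.1) F
    (fun k => by rw [hD0]; exact one_ne_zero)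
    (fun k => by rw [hN0, hD0, mul_one]; rfl)
    (fun k => ?_) (fun t ht htF => ?_) ?_
  · have h1 : Fintype.card {k : Fin n × Fin n // k ≠ (i₀, i₀)} = n ^ 2 - 1 := by
      rw [Fintype.card_subtype_compl]; simp [pow_two]
    have h2 : Fintype.card τ = ∑ j, r j := by simp [τ]
    rwa [h1, h2] at main
  · rw [hF]
    have h1 : (fun j => conjNum (M j : Matrix (Fin n) (Fin n) ℂ) (w j) (t' 0 j)) =
        fun j => (M j : Matrix (Fin n) (Fin n) ℂ) := funext fun j => conjNum_zero _ (w j)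
    have h2 : ∀ j, conjDen (w j) (t' 0 j) = 1 := fun j => conjDen_zero (w j)
    rw [h1, map_list_prod_ofFn_val, hprod]
    simp [h2]
  · have hDt : ∀ j, conjDen (w j) (t' t j) ≠ 0 := fun j => by
      rw [← hD]; exact ht (j, i₀, i₀)
    choose B hB hBe using fun j => exists_conj_eq_conjNum_div_conjDen (M j) (w j) (t' t j) (hDt j)
    refine ⟨B, ⟨fun j => mem_carrier_of_isConj (hC j) (hB j), ?_⟩, ?_⟩
    · have h1 : (fun j => conjNum (M j : Matrix (Fin n) (Fin n) ℂ) (w j) (t' t j)) =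
          fun j => conjDen (w j) (t' t j) • (B j : Matrix (Fin n) (Fin n) ℂ) := by
        ext j a b
        rw [Matrix.smul_apply, hBe, smul_eq_mul, mul_div_cancel₀ _ (hDt j)]
      have hne : ∏ j, conjDen (w j) (t' t j) ≠ 0 := Finset.prod_ne_zero_iff.2 fun j _ => hDt j
      apply Units.ext
      refine eq_one_of_det_eq_one i₀ _ (fun a b hab => ?_) ?_
      · have h2 := htF ⟨(a, b), hab⟩
        rw [hF, h1, list_prod_ofFn_smul, map_list_prod_ofFn_val, Matrix.smul_apply, smul_eq_mul,
          mul_comm, ← sub_mul, mul_eq_zero, or_iff_left hne, sub_eq_zero] at h2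
        exact h2
      · rw [det_list_prod_ofFn_eq_of_isConj hB, hprod]; simp
    · ext ⟨j, a, b⟩
      rw [hN, hD, ← hBe]
      rfl
  · rw [eq_bot_iff]
    intro v hv
    rw [Submodule.mem_bot]
    ext ⟨j, i⟩
    refine eq_zero_of_mem_tangentSpace_conj (fun i : Fin (r j) => (⟨j, i⟩ : τ))
      (M j : Matrix (Fin n) (Fin n) ℂ) (w j) (hw j) ?_
      (fun a b => Ideal.subset_span (Set.mem_range_self (j, a, b))) hv i
    rw [Ideal.span_le]
    rintro _ ⟨k, rfl⟩
    show _ ∈ vanishingIdeal ℂ {(0 : τ → ℂ)}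
    rw [mem_vanishingIdeal_singleton_iff, aeval_apply_eq_eval, map_sub, map_mul, hN0, hD0, eval_C,
      mul_one, sub_eq_zero]
    rfl

theorem sum_adRank_le_varietyDimAt_tupleVariety {n q : ℕ} (hn : 1 ≤ n)
    (C : Fin q → ConjClasses (GL (Fin n) ℂ)) (M : Fin q → GL (Fin n) ℂ)
    (hC : ∀ j, M j ∈ (C j).carrier) (hprod : (List.ofFn M).prod = 1) :
    ((∑ j, adRank (M j : Matrix (Fin n) (Fin n) ℂ) : ℕ) : WithBot ℕ∞) ≤
      varietyDimAt (tupleVariety C) (tupleEntries M) + ((n ^ 2 - 1 : ℕ) : WithBot ℕ∞) := by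
  choose w hw using fun j => exists_linearIndependent_sylvester (M j : Matrix (Fin n) (Fin n) ℂ)
  exact sum_le_varietyDimAt_tupleVariety hn C M hC hprod _ w hw

end

/-! ### Comparison of the two bounds. -/

theorem mainTheorem2 (n p : ℕ) (hn : 1 ≤ n)
    (C : Fin (p + 1) → ConjClasses (GL (Fin n) ℂ))
    (M : Fin (p + 1) → GL (Fin n) ℂ)
    (hC : ∀ j, M j ∈ (C j).carrier)
    (hprod : (List.ofFn M).prod = 1)
    (hM : HasTrivialCentralizer M) :
    IsSmoothPoint (tupleVariety C) (tupleEntries M) ∧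
      varietyDimAt (tupleVariety C) (tupleEntries M) + ((n ^ 2 : ℕ) : WithBot ℕ∞) =
        (∑ j, varietyDim (conjClassVariety (C j))) + 1 := by
  have hx := tupleEntries_mem_tupleVariety hC hprod
  have h1 := finrank_tangentSpace_tupleVariety_add_sq_le C M hC hprod hM
  have h2 := sum_adRank_le_varietyDimAt_tupleVariety hn C M hC hprod
  have h3 := varietyDimAt_le_finrank_tangentSpace hx
  set T := Module.finrank ℂ (MvPolynomial.tangentSpace
    (MvPolynomial.vanishingIdeal ℂ (tupleVariety C)) (tupleEntries M))
  set s := ∑ j, adRank (M j : Matrix (Fin n) (Fin n) ℂ)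
  have hn2 : 1 ≤ n ^ 2 := Nat.one_le_pow _ _ hn
  have h4 : (T : WithBot ℕ∞) ≤ varietyDimAt (tupleVariety C) (tupleEntries M) := by
    -- The finite summand `n ^ 2 - 1` may be cancelled, so both bounds can be compared before the
    -- dimension is known to be finite.
    rw [← ENat.WithBot.add_le_add_natCast_right_iff (c := n ^ 2 - 1)]
    refine le_trans ?_ h2
    have : T + (n ^ 2 - 1) ≤ s := by omega
    exact_mod_cast this
  have h5 := le_antisymm h3 h4
  have h6 : s ≤ T + (n ^ 2 - 1) := by
    rw [h5] at h2
    exact_mod_cast h2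
  refine ⟨isSmoothPoint_of_finrank_tangentSpace_le hx h4, ?_⟩
  rw [h5, Finset.sum_congr rfl fun j _ => varietyDim_conjClassVariety (C j) (hC j)]
  have h7 : T + n ^ 2 = s + 1 := by omega
  exact_mod_cast h7
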